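/- There is a deterministic algorithm which, given an odd integer $k\ge 1$ and integers $x_1,\ldots,x_{2k}$, constructs, in time polynomial in the bit size of the input $(x_1,\ldots,x_{2k})$, an integer $M\ge 1$ and integers $a_1,\ldots,a_{2k}$ with $\gcd(a_i,M)=1$ for all $i$, such that the following holds. Put $S=x_1+\cdots+x_{2k}$, and let $N_1,\ldots,N_{2k}$ be any integers with $N_i\equiv a_i\pmod M$ for $i=1,\ldots,2k$. Then: (i) for every set of $\ell\le k$ distinct indices $\{i_1,\ldots,i_\ell\}\subseteq\{1,\ldots,2k\}$, $$\gcd(2N_{i_1}\cdots N_{i_\ell}+1,\,M)=1\quad\Longleftrightarrow\quad \ell=k\ \text{ and }\ x_{i_1}+\cdots+x_{i_\ell}=S/2;$$ (ii) $N_i-1\nmid 4N_1\cdots N_{2k}$ for $i=1,\ldots,2k$; (iii) $\gcd(2N_1\cdots N_{2k}+1,\,M)>1$ and $\gcd(4N_1\cdots N_{2k}+1,\,M)>1$. (Here time is the number of bit operations, that is, the cost of a computation on a random access machine under the logarithmic cost criterion; the bit size of the input is the sum of the bit lengths of the $x_i$, each counted with a sign bit.) -/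

import Mathlib

/-! Polynomial time is measured on a random access machine over the integers under the
logarithmic cost criterion: every operation is charged according to the bit lengths of the
numbers that take part in it, so that a polynomial bound on the cost is a polynomial bound on
the number of bit operations (equivalently, on the running time of a multitape Turing machine).
A program is one fixed finite object that has to work for inputs of all lengths. -/

namespace RAM

/-- Bit length of an integer, including one bit for the sign: `1` for `0`, and
`⌊log₂ |z|⌋ + 2` for `z ≠ 0`. -/
def bitLen (z : ℤ) : ℕ := z.natAbs.size + 1

/-- Memory: integer registers `reg 0, reg 1, …` and integer arrays `arr 0, arr 1, …`.
A program names only finitely many of them; the cells of an array are addressed by integers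
that may be computed at run time (indirect addressing). -/
structure State where
  reg : ℕ → ℤ
  arr : ℕ → ℤ → ℤ

/-- The arithmetic instructions. -/
inductive Op where
  | add
  | sub
  | mul
  | div
  | mod

/-- Division is division with remainder, `0 ≤ u mod v < |v|` for `v ≠ 0`
(with `u div 0 = 0` and `u mod 0 = u`). -/
def Op.eval : Op → ℤ → ℤ → ℤ
  | .add, u, v => u + v
  | .sub, u, v => u - v
  | .mul, u, v => u * v
  | .div, u, v => u / v
  | .mod, u, v => u % v

/-- Arithmetic expressions. -/
inductive Exp where
  | const (c : ℤ)
  | reg (x : ℕ)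
  | read (a : ℕ) (i : Exp)
  | op (o : Op) (e f : Exp)

/-- The value of an expression. -/
def Exp.eval (s : State) : Exp → ℤ
  | .const c => c
  | .reg x => s.reg x
  | .read a i => s.arr a (i.eval s)
  | .op o e f => o.eval (e.eval s) (f.eval s)

/-- The cost of evaluating an expression. Fetching a number costs its bit length (plus, for an
array cell, the cost of computing its address); an arithmetic operation costs the product of the
bit lengths of its two operands, as in the schoolbook methods. -/
def Exp.cost (s : State) : Exp → ℕ
  | .const c => bitLen c
  | .reg x => bitLen (s.reg x)
  | .read a i => i.cost s + bitLen (i.eval s) + bitLen (s.arr a (i.eval s))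
  | .op _ e f => e.cost s + f.cost s + bitLen (e.eval s) * bitLen (f.eval s)

/-- Write the value `v` to register `x`. -/
def State.setReg (s : State) (x : ℕ) (v : ℤ) : State :=
  { s with reg := Function.update s.reg x v }

/-- Write the value `v` to cell `i` of array `a`. -/
def State.setArr (s : State) (a : ℕ) (i v : ℤ) : State :=
  { s with arr := Function.update s.arr a (Function.update (s.arr a) i v) }

/-- Programs: assignment to a register, assignment to an array cell, sequential composition,
branching and iteration. -/
inductive Prog where
  | skip
  | assign (x : ℕ) (e : Exp)
  | store (a : ℕ) (i e : Exp)
  | seq (p q : Prog)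
  | branch (e : Exp) (p q : Prog)
  | loop (e : Exp) (p : Prog)

/-- `Exec p s t s'`: started in memory state `s`, the program `p` halts in state `s'` after
a computation of total cost exactly `t`. The test of `branch` and of `loop` is `0 < e`. -/
inductive Exec : Prog → State → ℕ → State → Prop where
  | skip (s : State) : Exec .skip s 1 s
  | assign (s : State) (x : ℕ) (e : Exp) :
      Exec (.assign x e) s (e.cost s + bitLen (e.eval s)) (s.setReg x (e.eval s))
  | store (s : State) (a : ℕ) (i e : Exp) :
      Exec (.store a i e) s
        (i.cost s + e.cost s + bitLen (i.eval s) + bitLen (e.eval s))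
        (s.setArr a (i.eval s) (e.eval s))
  | seq {p q : Prog} {s s₁ s₂ : State} {t₁ t₂ : ℕ} :
      Exec p s t₁ s₁ → Exec q s₁ t₂ s₂ → Exec (.seq p q) s (t₁ + t₂) s₂
  | branch_pos {e : Exp} {p q : Prog} {s s₁ : State} {t : ℕ} :
      0 < e.eval s → Exec p s t s₁ → Exec (.branch e p q) s (e.cost s + 1 + t) s₁
  | branch_neg {e : Exp} {p q : Prog} {s s₁ : State} {t : ℕ} :
      ¬ 0 < e.eval s → Exec q s t s₁ → Exec (.branch e p q) s (e.cost s + 1 + t) s₁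
  | loop_stop {e : Exp} {p : Prog} {s : State} :
      ¬ 0 < e.eval s → Exec (.loop e p) s (e.cost s + 1) s
  | loop_step {e : Exp} {p : Prog} {s s₁ s₂ : State} {t₁ t₂ : ℕ} :
      0 < e.eval s → Exec p s t₁ s₁ → Exec (.loop e p) s₁ t₂ s₂ →
        Exec (.loop e p) s (e.cost s + 1 + t₁ + t₂) s₂

/-- The memory that presents the list `l` as input: register `0` holds the length of `l`, the
cells `0, 1, …` of array `0` hold its entries, and everything else is `0`. -/
def State.ofList (l : List ℤ) : State where
  reg x := if x = 0 then (l.length : ℤ) else 0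
  arr a i := if a = 0 ∧ 0 ≤ i then l.getD i.toNat 0 else 0

/-- The list that a memory state presents as output, by the same convention. -/
def State.toList (s : State) : List ℤ :=
  (List.range (s.reg 0).toNat).map fun i : ℕ => s.arr 0 (i : ℤ)

/-- On input `l` the program `p` halts with output `l'` after a computation of cost at
most `T`. -/
def Prog.OutputsWithin (p : Prog) (l l' : List ℤ) (T : ℕ) : Prop :=
  ∃ t s, t ≤ T ∧ Exec p (State.ofList l) t s ∧ s.toList = l'

/-- The size of an input: the total bit length of its entries. -/
def inputSize (l : List ℤ) : ℕ := (l.map bitLen).sum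

end RAM

/-! Say that a set I of indices is killed if some prime factor of M divides 2∏_{i∈I} a_i + 1. The
construction starts from M = 15 and a_i = 11. Modulo 3 every a_i is −1, so all sets of even size are
killed; modulo 5 every a_i is 1, which settles the claims about N_i − 1 and 4∏N_j + 1. No set of odd
size is killed yet. It remains to kill the sets of odd size l < k and the sets of size k that miss
half the sum S, sparing those that hit it. With z_i = 2k·x_i − S, a set I of size k is to be spared
exactly when Z = Σ_I z_i = k(2Σ_I x_i − S) is zero.

A round is given by a triple (l, q, u). With r = 1 + ls and d = qr it imposes a_i ≡ −2^(s + r·u·z_i)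
modulo a new divisor m of 2^d − 1. For |I| = l odd the value 2∏a_i + 1 becomes 1 − 2^(r(1 + u·Σ_I
z_i)), which vanishes as soon as q ∣ 1 + u·Σ_I z_i. For a set to be spared it is 1 − 2^(1+ks),
whatever the triple; hence m is taken as the part of 2^d − 1 prime to (2^(1+ks) − 1)M. That m is
large enough to kill follows from Bang's theorem (`exists_prime_orderOf_two`): some prime p has 2 of
order exactly d. Since s is chosen so that d exceeds all orders of 2 modulo the primes of M, and d ∤
1 + ks, this p survives in m.

Sets of size l < k are killed with q = 1. A set of size k with Z ≠ 0 is killed with a prime q ∤ Z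
and u ≡ −1/Z modulo q; by `exists_prime_le_not_dvd` such a q is at most 2c² when |Z| < 2^c. So
polynomially many triples deal with exponentially many sets. The order d grows by at most q(l+1) per
round, hence M keeps polynomially many bits, and m is found by gcds, without factoring.

For the running time, `Steps.exec` reduces the logarithmic cost to a count of instructions and a
bound on the stored numbers; both are obtained from loop invariants (`Run.loop`). -/

/-! ### Bang's theorem: primitive prime divisors of 2^d − 1. -/

open Polynomial in
/-- A prime factor of `Φ_d(2)` for which `2` does not have order `d` is the largest prime
factor of `d`. -/
theorem intrinsic_prime {d p : ℕ} (hd : 0 < d) (hp : p.Prime)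
    (hdvd : (p : ℤ) ∣ (cyclotomic d ℤ).eval 2) (hord : orderOf (2 : ZMod p) ≠ d) :
    ∃ j e : ℕ, d = p ^ (j + 1) * e ∧ ¬ p ∣ e ∧ orderOf (2 : ZMod p) = e ∧ p ≠ 2 := by
  have := Fact.mk hp
  have hroot : (cyclotomic d (ZMod p)).IsRoot 2 := by
    have h := (ZMod.intCast_zmod_eq_zero_iff_dvd ((cyclotomic d ℤ).eval 2) p).2 hdvd
    rw [← map_cyclotomic_int d (ZMod p), IsRoot.def]
    simpa using (eval_intCast_map (Int.castRingHom (ZMod p)) (cyclotomic d ℤ) 2).trans h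
  obtain ⟨j, e, he, hde⟩ := Nat.exists_eq_pow_mul_and_not_dvd hd.ne' p hp.ne_one
  -- In characteristic p, with p ∤ e, the roots of Φ_{p^j e} are those of Φ_e: the primitive e-th
  -- roots of unity.
  have hprim : IsPrimitiveRoot (2 : ZMod p) e := by
    have : NeZero (e : ZMod p) := ⟨by rwa [Ne, ZMod.natCast_eq_zero_iff]⟩
    subst hde
    rwa [isRoot_cyclotomic_prime_pow_mul_iff_of_charP] at hroot
  have hoe : orderOf (2 : ZMod p) = e := hprim.eq_orderOf.symm
  have he0 : e ≠ 0 := by rintro rfl; simp at he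
  have hp2 : p ≠ 2 := by
    rintro rfl
    have : (2 : ZMod 2) = 0 := rfl
    rw [this] at hprim
    exact zero_ne_one ((zero_pow he0).symm.trans hprim.pow_eq_one)
  rcases j with _ | j
  · exact absurd (by rw [hoe, hde]; simp) hord
  · exact ⟨j, e, hde, he, hoe, hp2⟩

open Polynomial in
-- For d = np with n = p^j e, the value Φ_d(2) divides (2^(np) − 1)/(2^n − 1), a geometric sum of p
-- terms. As p ∣ 2^n − 1, lifting the exponent shows that p divides this sum exactly once.
theorem intrinsic_prime_sq_not_dvd {p j e : ℕ} (hp : p.Prime) (hp2 : p ≠ 2)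
    (he : 0 < e) (hoe : orderOf (2 : ZMod p) = e) :
    ¬ ((p : ℤ) ^ 2 ∣ (cyclotomic (p ^ (j + 1) * e) ℤ).eval 2) := by
  intro hdvd
  have := Fact.mk hp
  set n := p ^ j * e with hn
  have hn0 : 0 < n := Nat.mul_pos (pow_pos hp.pos _) he
  have hd : p ^ (j + 1) * e = n * p := by rw [hn]; ring
  have h1 : (2 ^ n - 1) * (cyclotomic (n * p) ℤ).eval 2 ∣ (2 : ℤ) ^ (n * p) - 1 := by
    have := X_pow_sub_one_mul_cyclotomic_dvd_X_pow_sub_one_of_dvd ℤ (d := n) (n := n * p)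
      (Nat.mem_properDivisors.2 ⟨⟨p, rfl⟩, by nlinarith [hp.two_le]⟩)
    have h := map_dvd (evalRingHom (2 : ℤ)) this
    simpa using h
  rw [pow_mul 2 n p, ← geom_sum_mul ((2 : ℤ) ^ n) p, mul_comm _ ((2 : ℤ) ^ n - 1)] at h1
  have hpos : (2 : ℤ) ^ n - 1 ≠ 0 := by
    have : (2 : ℤ) ^ 1 ≤ 2 ^ n := pow_le_pow_right₀ (by norm_num) hn0
    omega
  have h2 := hdvd.trans (hd ▸ (mul_dvd_mul_iff_left hpos).1 h1)
  have hx : (p : ℤ) ∣ 2 ^ n - 1 := by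
    rw [← ZMod.intCast_zmod_eq_zero_iff_dvd]
    push_cast
    rw [hn, mul_comm, pow_mul, ← hoe, pow_orderOf_eq_one]; simp
  have hnx : ¬ (p : ℤ) ∣ 2 ^ n := by
    intro h
    have := (Nat.prime_iff_prime_int.1 hp).dvd_of_dvd_pow h
    have h3 : p ∣ 2 := by exact_mod_cast this
    exact hp2 ((Nat.prime_dvd_prime_iff_eq hp Nat.prime_two).1 h3)
  have h4 := emultiplicity_geom_sum₂_eq_one (Nat.prime_iff_prime_int.1 hp) (hp.odd_of_ne_two hp2)
    hx hnx
  simp only [one_pow, mul_one] at h4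
  have h5 := le_emultiplicity_of_pow_dvd h2
  rw [h4] at h5
  exact absurd h5 (by decide)

open Polynomial in
theorem eval_cyclotomic_prime_pow_mul {p : ℕ} (hp : p.Prime) (e j : ℕ) (x : ℝ) :
    (cyclotomic (p ^ (j + 1) * e) ℝ).eval x = (cyclotomic (p * e) ℝ).eval (x ^ p ^ j) := by
  induction j generalizing x with
  | zero => simp
  | succ j ih =>
    rw [show p ^ (j + 1 + 1) * e = p ^ (j + 1) * e * p by ring,
      ← cyclotomic_expand_eq_cyclotomic hp (Dvd.intro (p ^ j * e) (by ring)),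
      expand_eval, ih, ← pow_mul, ← pow_succ']

open Polynomial in
-- With y = 2^(p^j) the value is Φ_{pe}(y) = Φ_e(y^p)/Φ_e(y) ≥ ((y^p − 1)/(y + 1))^φ(e), and the
-- base of this power exceeds p. Among odd p, `h` excludes only p = 3, j = 0, where the base is 7/3.
theorem prime_lt_eval_cyclotomic {p e j : ℕ} (hp : p.Prime) (he : 0 < e) (hpe : ¬ p ∣ e)
    (h : 5 ≤ p ∨ 3 ≤ p ∧ 1 ≤ j) :
    (p : ℝ) < (cyclotomic (p ^ (j + 1) * e) ℝ).eval 2 := by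
  rw [eval_cyclotomic_prime_pow_mul hp]
  set y : ℝ := 2 ^ p ^ j with hy
  have hp3 : 3 ≤ p := by omega
  have key : (p : ℝ) * (y + 1) < y ^ p - 1 := by
    obtain ⟨n, rfl⟩ : ∃ n, p = n + 1 := ⟨p - 1, by omega⟩
    have hn : (n : ℝ) + 1 = ((n + 1 : ℕ) : ℝ) := by push_cast; ring
    rw [pow_succ]
    rcases h with h5 | ⟨-, hj⟩
    · have hy2 : (2 : ℝ) ≤ y := by
        have h1 : 1 ≤ (n + 1) ^ j := Nat.one_le_pow _ _ (by omega)
        calc (2 : ℝ) = 2 ^ 1 := by norm_num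
          _ ≤ y := pow_le_pow_right₀ (by norm_num) h1
      have h2 : (3 * (n + 1 : ℕ) + 1 : ℝ) ≤ 2 ^ n := by
        have : ∀ m, 4 ≤ m → 3 * (m + 1) + 1 ≤ 2 ^ m := by
          intro m hm
          induction m, hm using Nat.le_induction with
          | base => norm_num
          | succ m hm ih => rw [pow_succ]; omega
        exact_mod_cast this n (by omega)
      have h3 : (2 : ℝ) ^ n ≤ y ^ n := pow_le_pow_left₀ (by norm_num) hy2 n
      have hpos : (5 : ℝ) ≤ ((n + 1 : ℕ) : ℝ) := by exact_mod_cast h5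
      nlinarith
    · have hy8 : (8 : ℝ) ≤ y := by
        have h1 : 3 ≤ (n + 1) ^ j := hp3.trans (Nat.le_self_pow (by omega) _)
        calc (8 : ℝ) = 2 ^ 3 := by norm_num
          _ ≤ y := pow_le_pow_right₀ (by norm_num) h1
      have h2 : (3 * (n + 1 : ℕ) + 1 : ℝ) ≤ 8 ^ n := by
        have : ∀ m, 2 ≤ m → 3 * (m + 1) + 1 ≤ 8 ^ m := by
          intro m hm
          induction m, hm using Nat.le_induction with
          | base => norm_num
          | succ m hm ih => rw [pow_succ]; omega
        exact_mod_cast this n (by omega)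
      have h3 : (8 : ℝ) ^ n ≤ y ^ n := pow_le_pow_left₀ (by norm_num) hy8 n
      have hpos : (3 : ℝ) ≤ ((n + 1 : ℕ) : ℝ) := by exact_mod_cast hp3
      nlinarith
  have hy1 : 1 < y := one_lt_pow₀ (by norm_num) (pow_pos hp.pos j).ne'
  have hyp : 1 < y ^ p := one_lt_pow₀ hy1 hp.ne_zero
  have hE : (cyclotomic e ℝ).eval (y ^ p) = (cyclotomic (p * e) ℝ).eval y * (cyclotomic e ℝ).eval y := by
    rw [← expand_eval, cyclotomic_expand_eq_cyclotomic_mul hp hpe, eval_mul, mul_comm e p]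
  have h1 := sub_one_pow_totient_le_cyclotomic_eval hyp e
  have h2 := cyclotomic_eval_le_add_one_pow_totient hy1 e
  have hpos : 0 < (cyclotomic e ℝ).eval y := cyclotomic_pos' e hy1
  have hphi : e.totient ≠ 0 := (Nat.totient_pos.2 he).ne'
  have hp1 : (1 : ℝ) ≤ p := by exact_mod_cast hp.one_le
  have h3 : ((p : ℝ) * (y + 1)) ^ e.totient < (y ^ p - 1) ^ e.totient :=
    pow_lt_pow_left₀ key (by positivity) hphi
  have h4 : (p : ℝ) ≤ (p : ℝ) ^ e.totient := le_self_pow₀ hp1 hphi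
  rw [mul_pow] at h3
  by_contra! hle
  have h5 := mul_le_mul (hle.trans h4) h2 hpos.le (by positivity)
  rw [← hE] at h5
  linarith

open Polynomial in
/-- Bang's theorem: `2 ^ d - 1` has a primitive prime divisor for `d ≥ 7`. -/
theorem exists_prime_orderOf_two {d : ℕ} (hd : 7 ≤ d) :
    ∃ p : ℕ, p.Prime ∧ orderOf (2 : ZMod p) = d := by
  by_contra! hcon
  set F := (cyclotomic d ℤ).eval 2 with hF
  have hF1 : 1 < F.natAbs := by
    have := sub_one_lt_natAbs_cyclotomic_eval (n := d) (q := 2) (by omega) (by norm_num)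
    simpa using this
  have hdvd : ∀ p : ℕ, p ∣ F.natAbs ↔ (p : ℤ) ∣ F := fun p => Int.natCast_dvd.symm
  -- A second prime factor p' ≠ p has order e' with p ∣ d = p'^(j'+1) e', so p ∣ e' ∣ p' − 1. By
  -- symmetry two distinct prime factors cannot coexist.
  have hlt : ∀ p : ℕ, p.Prime → p ∣ F.natAbs → ∀ p' : ℕ, p'.Prime → p' ∣ F.natAbs → p ≠ p' → p < p' := by
    intro p hp hpF p' hp' hpF' hne
    have := Fact.mk hp'
    obtain ⟨j, e, hde, -, -, -⟩ := intrinsic_prime (by omega) hp ((hdvd p).1 hpF) (hcon p hp)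
    obtain ⟨j', e', hde', -, ho', hp2⟩ :=
      intrinsic_prime (by omega) hp' ((hdvd p').1 hpF') (hcon p' hp')
    have h1 : p ∣ p' ^ (j' + 1) * e' := by
      rw [← hde', hde, pow_succ]; exact Dvd.intro_left (p ^ j * e) (by ring)
    have h2 : p ∣ e' := (hp.dvd_mul.1 h1).resolve_left fun h =>
      hne ((Nat.prime_dvd_prime_iff_eq hp hp').1 (hp.dvd_of_dvd_pow h))
    have h3 : (2 : ZMod p') ≠ 0 := by
      intro h
      have : ((2 : ℕ) : ZMod p') = 0 := by exact_mod_cast h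
      rw [ZMod.natCast_eq_zero_iff] at this
      exact hp2 ((Nat.prime_dvd_prime_iff_eq hp' Nat.prime_two).1 this)
    have h4 : e' ∣ p' - 1 := ho' ▸ ZMod.orderOf_dvd_card_sub_one h3
    have h5 := Nat.le_of_dvd (by have := hp'.two_le; omega) (h2.trans h4)
    have := hp'.two_le
    omega
  obtain ⟨p, hp, hpF⟩ := Nat.exists_prime_and_dvd hF1.ne'
  have huniq : ∀ {q : ℕ}, q.Prime → q ∣ F.natAbs → q = p := by
    intro q hq hqF
    by_contra hne
    exact lt_asymm (hlt q hq hqF p hp hpF hne) (hlt p hp hpF q hq hqF (Ne.symm hne))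
  obtain ⟨j, e, hde, hpe, hoe, hp2⟩ := intrinsic_prime (by omega) hp ((hdvd p).1 hpF) (hcon p hp)
  have he : 0 < e := Nat.pos_of_ne_zero (by rintro rfl; simp at hpe)
  have hpow := Nat.eq_prime_pow_of_unique_prime_dvd (by omega) huniq
  have hle : F.natAbs ≤ p := by
    rw [hpow]
    rcases Nat.lt_or_ge 1 F.natAbs.primeFactorsList.length with h | h
    · exfalso
      apply intrinsic_prime_sq_not_dvd (j := j) hp hp2 he hoe
      rw [← hde]
      have h2 : p ^ 2 ∣ F.natAbs := hpow ▸ pow_dvd_pow p h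
      exact_mod_cast (hdvd (p ^ 2)).1 h2
    · calc p ^ _ ≤ p ^ 1 := Nat.pow_le_pow_right hp.pos h
        _ = p := pow_one p
  have hp3 : 3 ≤ p := by have := hp.two_le; omega
  -- The case p = 3, j = 0 has d = 3e with e ≤ 2, hence d ≤ 6; d = 6 is a genuine exception.
  have hcase : 5 ≤ p ∨ 3 ≤ p ∧ 1 ≤ j := by
    by_contra! hc
    have hj : j = 0 := by have := hc.2 hp3; omega
    have hp4 : p ≠ 4 := by rintro rfl; norm_num at hp
    have hp3' : p = 3 := by omega
    subst hp3' hj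
    have : orderOf (2 : ZMod 3) ≤ 2 := orderOf_le_of_pow_eq_one (by norm_num) (by decide)
    omega
  have hbig := prime_lt_eval_cyclotomic (j := j) hp he hpe hcase
  rw [← hde] at hbig
  have hcast : (cyclotomic d ℝ).eval 2 = (F : ℝ) := by
    rw [← map_cyclotomic_int d ℝ]
    exact eval_intCast_map (Int.castRingHom ℝ) (cyclotomic d ℤ) 2
  rw [hcast] at hbig
  have h6 : (F : ℝ) ≤ (F.natAbs : ℝ) := by
    rw [Nat.cast_natAbs]; exact_mod_cast le_abs_self F
  have h7 : (F.natAbs : ℝ) ≤ p := by exact_mod_cast hle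
  linarith

/-! ### A small prime not dividing a given number. -/

/-- Some prime at most `2c²` fails to divide a given nonzero number below `2 ^ c`. -/
theorem exists_prime_le_not_dvd {c z : ℕ} (hc : 7 ≤ c) (hz : z ≠ 0) (hzc : z < 2 ^ c) :
    ∃ q : ℕ, q.Prime ∧ q ≤ 2 * c ^ 2 ∧ ¬ q ∣ z := by
  -- If all primes up to X divided z, their product would force their number n below c, and
  -- Chebyshev's bound would give 2^X ≤ (X+1)·lcm(1,…,X) ≤ (X+1)·X^n ≤ 2^(c²), against X = 2c².
  by_contra! hcon
  set X := 2 * c ^ 2 with hX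
  have hprim : ∏ p ∈ Nat.primesLE X, p ∣ z := by
    refine Finset.prod_primes_dvd z (fun p hp => ?_) (fun p hp => ?_)
    · exact (Nat.prime_iff.1 (Nat.mem_primesLE.1 hp).2)
    · exact hcon p (Nat.mem_primesLE.1 hp).2 (Nat.mem_primesLE.1 hp).1
  set n := (Nat.primesLE X).card with hn
  have h1 : 2 ^ n ≤ z := by
    refine le_trans ?_ (Nat.le_of_dvd (Nat.pos_of_ne_zero hz) hprim)
    exact Finset.pow_card_le_prod _ _ _ fun p hp => (Nat.mem_primesLE.1 hp).2.two_le
  have hnc : n < c := (Nat.pow_lt_pow_iff_right (by norm_num)).1 (h1.trans_lt hzc)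
  have h2 := Chebyshev.two_pow_le_mul_lcmUpto X
  have hX0 : X ≠ 0 := by positivity
  have h3 : Nat.lcmUpto X ≤ X ^ n := by
    rw [Nat.lcmUpto_eq_prod_pow_log]
    exact Finset.prod_le_pow_card _ _ _ fun p hp => Nat.pow_log_le_self p hX0
  have h4 : ∀ m, 7 ≤ m → 2 * m ^ 2 + 1 ≤ 2 ^ m := by
    intro m hm
    induction m, hm using Nat.le_induction with
    | base => norm_num
    | succ m hm ih => rw [pow_succ 2 m]; nlinarith
  have h5 : X + 1 ≤ 2 ^ c := h4 c hc
  have h6 : (X + 1) * Nat.lcmUpto X ≤ (2 ^ c) ^ c := by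
    calc (X + 1) * Nat.lcmUpto X ≤ (2 ^ c) * (2 ^ c) ^ n :=
          Nat.mul_le_mul h5 (h3.trans (Nat.pow_le_pow_left (by omega) n))
      _ = (2 ^ c) ^ (n + 1) := by ring
      _ ≤ _ := Nat.pow_le_pow_right (by positivity) hnc
  rw [← pow_mul] at h6
  have h7 := (Nat.pow_le_pow_iff_right (by norm_num : 1 < 2)).1 (h2.trans h6)
  nlinarith

/-! ### Residues −2^e and the effect of one round. -/

theorem two_pow_modEq_of_dvd {m : ℤ} {d a b : ℕ} (hm : m ∣ 2 ^ d - 1) (h : a ≡ b [MOD d]) :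
    (2 : ℤ) ^ a ≡ 2 ^ b [ZMOD m] := by
  have hd : (2 : ℤ) ^ d ≡ 1 [ZMOD m] := (Int.modEq_iff_dvd.2 hm).symm
  have key : ∀ n : ℕ, (2 : ℤ) ^ n ≡ 2 ^ (n % d) [ZMOD m] := fun n => by
    conv_lhs => rw [← Nat.div_add_mod n d, pow_add, pow_mul]
    simpa using (hd.pow (n / d)).mul_right (2 ^ (n % d))
  exact (key a).trans ((congrArg _ h : (2 : ℤ) ^ (a % d) = 2 ^ (b % d)) ▸ (key b).symm)

theorem natCast_dvd_two_pow_sub_one_iff {p : ℕ} (e : ℕ) :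
    (p : ℤ) ∣ 2 ^ e - 1 ↔ orderOf (2 : ZMod p) ∣ e := by
  rw [← ZMod.intCast_zmod_eq_zero_iff_dvd, orderOf_dvd_iff_pow_eq_one, Int.cast_sub, sub_eq_zero]
  push_cast
  rfl

section Moduli

variable {ι : Type*}

/-- The product over `I` is killed by `M`: some prime factor of `M` divides
`2 * ∏ i ∈ I, a i + 1`. -/
def Kills (M : ℤ) (a : ι → ℤ) (I : Finset ι) : Prop :=
  ∃ p : ℕ, p.Prime ∧ (p : ℤ) ∣ M ∧ (p : ℤ) ∣ 2 * ∏ i ∈ I, a i + 1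

/-- The properties of the modulus and of the residues that every round preserves. -/
structure Admissible (k : ℕ) (z : ι → ℤ) (D : ℕ) (M : ℤ) (a : ι → ℤ) : Prop where
  pos : 0 < M
  fifteen_dvd : 15 ∣ M
  modEq : ∀ i, a i ≡ 11 [ZMOD 15]
  coprime : ∀ i, IsCoprime (a i) M
  survive : ∀ I : Finset ι, I.card = k → ∑ i ∈ I, z i = 0 → IsCoprime (2 * ∏ i ∈ I, a i + 1) M
  -- Because of this bound on the orders of 2, a prime with 2 of order above D cannot divide M.
  order : ∀ p : ℕ, p.Prime → (p : ℤ) ∣ M → ∃ e, 0 < e ∧ e ≤ D ∧ (p : ℤ) ∣ 2 ^ e - 1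

theorem Int.isCoprime_of_modEq {a b m : ℤ} (h : a ≡ b [ZMOD m]) (hb : IsCoprime b m) :
    IsCoprime a m := by
  obtain ⟨c, hc⟩ := Int.modEq_iff_dvd.1 h
  have : a = b + m * (-c) := by linarith
  rw [this]
  exact IsCoprime.add_mul_left_left hb (-c)

theorem prod_modEq_prod {a b : ι → ℤ} {m : ℤ} (I : Finset ι) (h : ∀ i, a i ≡ b i [ZMOD m]) :
    ∏ i ∈ I, a i ≡ ∏ i ∈ I, b i [ZMOD m] := by
  induction I using Finset.cons_induction with
  | empty => rfl
  | cons i I hi ih => rw [Finset.prod_cons, Finset.prod_cons]; exact (h i).mul ih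

theorem two_mul_prod_add_one_modEq {a b : ι → ℤ} {m : ℤ} (I : Finset ι)
    (h : ∀ i, a i ≡ b i [ZMOD m]) :
    2 * ∏ i ∈ I, a i + 1 ≡ 2 * ∏ i ∈ I, b i + 1 [ZMOD m] :=
  ((prod_modEq_prod I h).mul_left 2).add_right 1

theorem Kills.congr {M M' : ℤ} {a a' : ι → ℤ} {I : Finset ι} (h : Kills M a I) (hM : M ∣ M')
    (ha : ∀ i, a' i ≡ a i [ZMOD M]) : Kills M' a' I := by
  obtain ⟨p, hp, hpM, hpa⟩ := h
  refine ⟨p, hp, hpM.trans hM, ?_⟩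
  have h1 := two_mul_prod_add_one_modEq I fun i => (ha i).of_dvd hpM
  exact (Int.ModEq.dvd_iff h1).2 hpa

/-- Since 11² ≡ 1 modulo 15, an odd number of factors leaves 2·11 + 1 = 23, which is prime to 15.
The bound 4 on orders comes from 15 = 2^4 − 1. -/
theorem Admissible.base {k : ℕ} (hk : Odd k) (z : ι → ℤ) {D : ℕ} (hD : 4 ≤ D) :
    Admissible k z D 15 fun _ => 11 where
  pos := by norm_num
  fifteen_dvd := dvd_rfl
  modEq _ := rfl
  coprime _ := ⟨-4, 3, by norm_num⟩
  survive I hI _ := by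
    rw [Finset.prod_const, hI]
    obtain ⟨t, rfl⟩ := hk
    have h : (2 : ℤ) * 11 ^ (2 * t + 1) + 1 ≡ 23 [ZMOD 15] := by
      rw [pow_succ, pow_mul]
      have : (11 : ℤ) ^ 2 ≡ 1 [ZMOD 15] := by decide
      have := (((this.pow t).mul_right 11).mul_left 2).add_right 1
      simpa using this
    exact Int.isCoprime_of_modEq h ⟨2, -3, by norm_num⟩
  order p _ hp := ⟨4, by norm_num, hD, by simpa using hp⟩

theorem sum_toNat_emod_modEq {d : ℕ} (hd : 0 < d) (I : Finset ι) (g : ι → ℤ) :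
    ((∑ i ∈ I, (g i % d).toNat : ℕ) : ℤ) ≡ ∑ i ∈ I, g i [ZMOD d] := by
  push_cast
  induction I using Finset.cons_induction with
  | empty => rfl
  | cons i I hi ih =>
    rw [Finset.sum_cons, Finset.sum_cons]
    refine Int.ModEq.add ?_ ih
    rw [Int.toNat_of_nonneg (Int.emod_nonneg _ (by omega))]
    exact Int.mod_modEq _ _

/-- With residues `-2 ^ e i` modulo a divisor of `2 ^ d - 1`, the value `2 * ∏ a i + 1` over an
odd number of indices is `1 - 2 ^ n` for any `n ≡ 1 + ∑ e i` modulo `d`. -/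
theorem two_mul_prod_add_one_modEq_of_odd {m : ℤ} {d : ℕ} (hd : 0 < d) (hm : m ∣ 2 ^ d - 1)
    {a g : ι → ℤ} (ha : ∀ i, a i ≡ -2 ^ (g i % d).toNat [ZMOD m]) {I : Finset ι}
    (hI : Odd I.card) {n : ℕ} (hn : 1 + ∑ i ∈ I, g i ≡ n [ZMOD d]) :
    2 * ∏ i ∈ I, a i + 1 ≡ -(2 ^ n - 1) [ZMOD m] := by
  have h1 : 1 + ∑ i ∈ I, (g i % d).toNat ≡ n [MOD d] := by
    rw [← Int.natCast_modEq_iff]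
    refine Int.ModEq.trans ?_ hn
    push_cast
    have := (sum_toNat_emod_modEq hd I g).add_left 1
    push_cast at this
    exact this
  have h2 := (two_pow_modEq_of_dvd hm h1).neg.add_right 1
  refine (two_mul_prod_add_one_modEq I ha).trans ?_
  rw [show -((2 : ℤ) ^ n - 1) = -2 ^ n + 1 by ring]
  convert h2 using 1
  rw [Finset.prod_neg, hI.neg_one_pow, Finset.prod_pow_eq_pow_sum]
  ring

/-- One round: the modulus `m` is added, with `a' i ≡ -2 ^ (s + r u z i)` modulo `m`, where
`r = 1 + l s` and `m` is the part of `2 ^ (q r) - 1` prime to `(2 ^ (1 + k s) - 1) M`. -/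
structure Round (k : ℕ) (z : ι → ℤ) (l q u s : ℕ) (M m : ℤ) (a a' : ι → ℤ) : Prop where
  pos : 0 < m
  dvd : m ∣ 2 ^ (q * (1 + l * s)) - 1
  coprime : IsCoprime m ((2 ^ (1 + k * s) - 1) * M)
  -- Only the primes have to be kept; multiplicities play no role.
  full : ∀ p : ℕ, p.Prime → (p : ℤ) ∣ 2 ^ (q * (1 + l * s)) - 1 →
    ¬ (p : ℤ) ∣ (2 ^ (1 + k * s) - 1) * M → (p : ℤ) ∣ m
  modEq_old : ∀ i, a' i ≡ a i [ZMOD M]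
  modEq_new : ∀ i, a' i ≡
    -2 ^ (((s : ℤ) + (1 + l * s) * u * z i) % (q * (1 + l * s) : ℕ)).toNat [ZMOD m]

variable {k : ℕ} {z : ι → ℤ} {l q u s : ℕ} {M m : ℤ} {a a' : ι → ℤ} {D : ℕ}

theorem Round.sum_eq (I : Finset ι) :
    1 + ∑ i ∈ I, ((s : ℤ) + (1 + l * s) * u * z i) =
      1 + I.card * s + (1 + l * s) * u * ∑ i ∈ I, z i := by
  rw [Finset.sum_add_distrib, Finset.sum_const, nsmul_eq_mul, ← Finset.mul_sum]
  ring

/-- A set to be spared has Σ z = 0, so its exponent is 1 + ks independently of l, q and u, and m is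
prime to 2^(1+ks) − 1. The new residues are units because m, a divisor of 2^d − 1, is odd. -/
theorem Round.admissible (h : Round k z l q u s M m a a') (hA : Admissible k z D M a)
    (hk : Odd k) (hq : 0 < q) (hs : D ≤ q * (1 + l * s)) :
    Admissible k z (q * (1 + l * s)) (M * m) a' where
  pos := mul_pos hA.pos h.pos
  fifteen_dvd := hA.fifteen_dvd.mul_right m
  modEq i := ((h.modEq_old i).of_dvd hA.fifteen_dvd).trans (hA.modEq i)
  coprime i := by
    refine IsCoprime.mul_right (Int.isCoprime_of_modEq (h.modEq_old i) (hA.coprime i))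
      (Int.isCoprime_of_modEq (h.modEq_new i) (IsCoprime.neg_left (IsCoprime.pow_left ?_)))
    obtain ⟨c, hc⟩ := h.dvd
    obtain ⟨n, hn⟩ : ∃ n, q * (1 + l * s) = n + 1 :=
      ⟨q * (1 + l * s) - 1, by have : 0 < q * (1 + l * s) := by positivity
                               omega⟩
    rw [hn, pow_succ] at hc
    exact ⟨2 ^ n, -c, by linarith⟩
  survive I hI hz := by
    refine IsCoprime.mul_right (Int.isCoprime_of_modEq
      (two_mul_prod_add_one_modEq I h.modEq_old) (hA.survive I hI hz)) ?_
    refine Int.isCoprime_of_modEq (two_mul_prod_add_one_modEq_of_odd (by positivity) h.dvd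
      h.modEq_new (hI ▸ hk) (n := 1 + k * s) ?_) (h.coprime.of_mul_right_left.symm.neg_left)
    rw [Round.sum_eq, hI, hz]
    push_cast
    simp
  order p hp hpM := by
    rcases (Nat.prime_iff_prime_int.1 hp).dvd_mul.1 hpM with h1 | h1
    · obtain ⟨e, he, heD, hpe⟩ := hA.order p hp h1
      exact ⟨e, he, heD.trans hs, hpe⟩
    · exact ⟨_, by positivity, le_rfl, h1.trans h.dvd⟩

theorem Round.kills_of_kills (h : Round k z l q u s M m a a') {I : Finset ι}
    (hI : Kills M a I) : Kills (M * m) a' I :=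
  hI.congr (Dvd.intro m rfl) h.modEq_old

/-- Bang's theorem yields a prime p with 2 of order exactly d = q(1 + ls). It does not divide
2^(1+ks) − 1, as d ∤ 1 + ks, nor M, as d > D; so it divides m. By `hu` the exponent of 2 attached to
I is a multiple of d. The bound 6 ≤ D ensures d ≥ 7. -/
theorem Round.kills (h : Round k z l q u s M m a a') (hA : Admissible k z D M a)
    (hs : D < q * (1 + l * s)) (hD : 6 ≤ D) (hks : ¬ q * (1 + l * s) ∣ 1 + k * s)
    {I : Finset ι} (hI : I.card = l) (hl : Odd l)
    (hu : (q : ℤ) ∣ 1 + u * ∑ i ∈ I, z i) : Kills (M * m) a' I := by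
  obtain ⟨p, hp, hord⟩ := exists_prime_orderOf_two (d := q * (1 + l * s)) (by omega)
  have hpm : (p : ℤ) ∣ m := by
    refine h.full p hp ((natCast_dvd_two_pow_sub_one_iff _).2 hord.dvd) fun hcon => ?_
    rcases (Nat.prime_iff_prime_int.1 hp).dvd_mul.1 hcon with h1 | h1
    · rw [natCast_dvd_two_pow_sub_one_iff, hord] at h1
      exact hks h1
    · obtain ⟨e, he, heD, hpe⟩ := hA.order p hp h1
      rw [natCast_dvd_two_pow_sub_one_iff, hord] at hpe
      have := Nat.le_of_dvd he hpe
      omega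
  refine ⟨p, hp, hpm.mul_left M, ?_⟩
  have h1 := two_mul_prod_add_one_modEq_of_odd (by omega) h.dvd h.modEq_new (hI ▸ hl) (n := 0) (by
    rw [Round.sum_eq, hI]
    refine (Int.modEq_iff_dvd.2 ?_)
    obtain ⟨c, hc⟩ := hu
    refine ⟨-c, ?_⟩
    push_cast
    linear_combination (-(1 + l * s : ℤ)) * hc)
  simpa using (Int.ModEq.dvd_iff (h1.of_dvd hpm)).2 (by simp)

end Moduli

/-! ### The schedule of rounds. -/

section Moduli
variable {ι : Type*}
/-- `2 * ∏ i ∈ I, a i + 1` has to be killed in round `j`, where `j` encodes `(l, q, u)`. -/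
def Scheduled (k X : ℕ) (z : ι → ℤ) (j : ℕ) (I : Finset ι) : Prop :=
  -- The encoding is j = (l − 1) + k((q − 1) + X·u). The last clause admits the two useful kinds of
  -- triple: l < k with q = 1, and l = k with q ≥ 2.
  I.card = j % k + 1 ∧ Odd I.card ∧
    (((j / k) % X + 1 : ℕ) : ℤ) ∣ 1 + (j / (k * X) : ℕ) * ∑ i ∈ I, z i ∧
    (j % k + 1 < k ∧ (j / k) % X + 1 = 1 ∨ j % k + 1 = k ∧ 2 ≤ (j / k) % X + 1)

/-- The triple is l = |I|, q = 1, u = 0, for which the divisibility is void. -/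
theorem exists_scheduled_of_card_lt {k X : ℕ} (hX : 0 < X) (z : ι → ℤ) {I : Finset ι}
    (hI : Odd I.card) (hIk : I.card < k) : ∃ j < k * X * X, Scheduled k X z j I := by
  obtain ⟨t, ht⟩ := hI
  have hj : (I.card - 1) % k = I.card - 1 := Nat.mod_eq_of_lt (by omega)
  have hj2 : (I.card - 1) / k = 0 := Nat.div_eq_of_lt (by omega)
  refine ⟨I.card - 1, ?_, ?_, ⟨t, ht⟩, ?_, Or.inl ⟨?_, ?_⟩⟩
  · calc I.card - 1 < k := by omega
      _ ≤ k * (X * X) := Nat.le_mul_of_pos_right _ (by positivity)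
      _ = _ := by ring
  · omega
  · simp [hj2]
  · omega
  · simp [hj2]

/-- Here q is a small prime not dividing Z = Σ_I z_i, and u < q is the residue of −α for a Bézout
identity αZ + βq = 1, so that q ∣ 1 + uZ. -/
theorem exists_scheduled_of_sum_ne_zero {k c : ℕ} (hk : Odd k) (hc : 7 ≤ c) {z : ι → ℤ}
    {I : Finset ι} (hI : I.card = k) (hz : ∑ i ∈ I, z i ≠ 0)
    (hzc : (∑ i ∈ I, z i).natAbs < 2 ^ c) :
    ∃ j < k * (2 * c ^ 2) * (2 * c ^ 2), Scheduled k (2 * c ^ 2) z j I := by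
  obtain ⟨q, hq, hqX, hqz⟩ := exists_prime_le_not_dvd hc (Int.natAbs_ne_zero.2 hz) hzc
  set X := 2 * c ^ 2
  set Z := ∑ i ∈ I, z i
  have hk0 := hk.pos
  have hcop : IsCoprime Z (q : ℤ) := by
    rw [Int.isCoprime_iff_gcd_eq_one, Int.gcd_comm]
    exact (Nat.Prime.coprime_iff_not_dvd hq).2 hqz
  obtain ⟨α, β, hαβ⟩ := hcop
  have hq0 : (0 : ℤ) < q := by exact_mod_cast hq.pos
  set u := ((-α) % q).toNat with hu
  have hu' : (u : ℤ) = (-α) % q := Int.toNat_of_nonneg (Int.emod_nonneg _ hq0.ne')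
  have huq : u < q := by have := Int.emod_lt_of_pos (-α) hq0; omega
  have hq2 := hq.two_le
  have h1 : (k - 1 + k * (q - 1 + X * u)) / k = q - 1 + X * u := by
    rw [Nat.add_mul_div_left _ _ hk0, Nat.div_eq_of_lt (by omega), zero_add]
  have h2 : (k - 1 + k * (q - 1 + X * u)) % k = k - 1 := by
    rw [Nat.add_mul_mod_self_left, Nat.mod_eq_of_lt (by omega)]
  have h3 : (q - 1 + X * u) % X = q - 1 := by
    rw [Nat.add_mul_mod_self_left, Nat.mod_eq_of_lt (by omega)]
  have h4 : (q - 1 + X * u) / X = u := by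
    rw [Nat.add_mul_div_left _ _ (by omega), Nat.div_eq_of_lt (by omega), zero_add]
  have hkk : k - 1 + 1 = k := by omega
  have hqq : q - 1 + 1 = q := by omega
  refine ⟨k - 1 + k * (q - 1 + X * u), ?_, ?_, hI ▸ hk, ?_, Or.inr ⟨?_, ?_⟩⟩
  · have h5 : q - 1 + X * u + 1 ≤ X * X := by
      calc q - 1 + X * u + 1 ≤ X + X * u := by omega
        _ = X * (u + 1) := by ring
        _ ≤ X * X := Nat.mul_le_mul_left _ (by omega)
    calc k - 1 + k * (q - 1 + X * u) < k * (q - 1 + X * u + 1) := by rw [mul_add_one]; omega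
      _ ≤ k * (X * X) := Nat.mul_le_mul_left _ h5
      _ = _ := by ring
  · rw [h2, hkk, hI]
  · rw [← Nat.div_div_eq_div_mul, h1, h3, h4, hqq, hu', Int.dvd_iff_emod_eq_zero, Int.add_emod,
      Int.mul_emod, Int.emod_emod, ← Int.mul_emod, ← Int.add_emod, ← Int.dvd_iff_emod_eq_zero]
    exact ⟨β, by linarith⟩
  · rw [h2, hkk]
  · rw [h1, h3, hqq]; exact hq2

/-- The point is d ∤ 1 + ks. If q = 1 and l < k, divisibility would give 1 + ls ∣ (k − l)s, hence 1
+ ls ∣ k − l, but 1 + ls > D ≥ k + 6. If l = k and q ≥ 2, then d = q(1 + ks) is too large. -/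
theorem Round.kills_of_scheduled {k X D j : ℕ} {z : ι → ℤ} {M m : ℤ} {a a' : ι → ℤ}
    (h : Round k z (j % k + 1) ((j / k) % X + 1) (j / (k * X))
      (D / (((j / k) % X + 1) * (j % k + 1)) + 1) M m a a') (hA : Admissible k z D M a)
    (hs : D < ((j / k) % X + 1) *
      (1 + (j % k + 1) * (D / (((j / k) % X + 1) * (j % k + 1)) + 1)))
    (hD : k + 6 ≤ D) {I : Finset ι} (hI : Scheduled k X z j I) : Kills (M * m) a' I := by
  obtain ⟨h1, h2, h3, h4⟩ := hI
  refine h.kills hA hs (by omega) ?_ h1 (h1 ▸ h2) h3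
  generalize D / (((j / k) % X + 1) * (j % k + 1)) + 1 = s at *
  generalize (j / k) % X + 1 = q at *
  generalize j % k + 1 = l at *
  intro hdvd
  rcases h4 with ⟨h4, rfl⟩ | ⟨rfl, h4⟩
  · rw [one_mul] at hdvd hs
    have h5 : 1 + l * s ∣ (k - l) * s := by
      have := Nat.dvd_sub hdvd (dvd_refl (1 + l * s))
      rwa [Nat.add_sub_add_left, ← Nat.sub_mul] at this
    have h6 : Nat.Coprime (1 + l * s) s := by
      simp
    have := Nat.le_of_dvd (by omega) (h6.dvd_of_dvd_mul_right h5)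
    omega
  · have := Nat.le_of_dvd (by positivity) hdvd
    nlinarith [Nat.zero_le (l * s)]

/-- The value s = D/(ql) + 1 is the least with qls > D. Thus the new order passes D, but only by an
additive amount, which keeps the orders polynomial over all rounds. -/
theorem lt_next_order (D l q : ℕ) (hl : 0 < l) (hq : 0 < q) :
    D < q * (1 + l * (D / (q * l) + 1)) := by
  have := Nat.lt_mul_div_succ D (Nat.mul_pos hq hl)
  calc D < q * l * (D / (q * l) + 1) := this
    _ ≤ q * (1 + l * (D / (q * l) + 1)) := by rw [mul_assoc]; exact Nat.mul_le_mul_left _ (by omega)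

theorem next_order_le (D l q : ℕ) :
    q * (1 + l * (D / (q * l) + 1)) ≤ D + q * (l + 1) := by
  have := Nat.mul_div_le D (q * l)
  calc q * (1 + l * (D / (q * l) + 1)) = q * l * (D / (q * l)) + q * (l + 1) := by ring
    _ ≤ _ := by omega

/-! ### From killed and surviving sets to the gcd conditions. -/

/-- After all rounds every product that is not to survive has been killed. -/
theorem conclusion {k c D : ℕ} (hk : Odd k) (hc : 7 ≤ c) {x : Fin (2 * k) → ℤ} {M : ℕ}
    {a : Fin (2 * k) → ℤ}
    (hV : k * ∑ i, x i * x i < 2 ^ c)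
    (hA : Admissible k (fun i => (2 * k : ℕ) * x i - ∑ i, x i) D M a)
    (hK : ∀ j < k * (2 * c ^ 2) * (2 * c ^ 2), ∀ I,
      Scheduled k (2 * c ^ 2) (fun i => (2 * k : ℕ) * x i - ∑ i, x i) j I → Kills M a I) :
    0 < M ∧
      (∀ i, Int.gcd (a i) M = 1) ∧
      ∀ (N : Fin (2 * k) → ℤ), (∀ i, N i ≡ a i [ZMOD M]) →
        (∀ I : Finset (Fin (2 * k)), I.card ≤ k →
          (Int.gcd (2 * ∏ i ∈ I, N i + 1) M = 1 ↔
            I.card = k ∧ ∑ i ∈ I, (x i : ℚ) = (∑ i, (x i : ℚ)) / 2)) ∧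
        (∀ i, ¬ (N i - 1 ∣ 4 * ∏ j, N j)) ∧
        1 < Int.gcd (2 * ∏ j, N j + 1) M ∧
        1 < Int.gcd (4 * ∏ j, N j + 1) M := by
  have hM : 0 < M := by exact_mod_cast hA.pos
  refine ⟨hM, fun i => Int.isCoprime_iff_gcd_eq_one.1 (hA.coprime i), fun N hN => ?_⟩
  have hN15 : ∀ i, N i ≡ 11 [ZMOD 15] := fun i =>
    ((hN i).of_dvd hA.fifteen_dvd).trans (hA.modEq i)
  have hN3 : ∀ i, N i ≡ -1 [ZMOD 3] := fun i => ((hN15 i).of_dvd (by norm_num)).trans (by decide)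
  have hN5 : ∀ i, N i ≡ 1 [ZMOD 5] := fun i => ((hN15 i).of_dvd (by norm_num)).trans (by decide)
  have hM3 : (3 : ℤ) ∣ M := Dvd.dvd.trans (by norm_num) hA.fifteen_dvd
  have hM5 : (5 : ℤ) ∣ M := Dvd.dvd.trans (by norm_num) hA.fifteen_dvd
  have hgcd : ∀ (p : ℕ) (v : ℤ), 1 < p → (p : ℤ) ∣ M → (p : ℤ) ∣ v → 1 < Int.gcd v M := by
    intro p v hp hpM hpv
    refine hp.trans_le (Nat.le_of_dvd (Int.gcd_pos_of_ne_zero_right _ (by omega)) ?_)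
    exact Int.natCast_dvd_natCast.1 (Int.dvd_coe_gcd hpv hpM)
  have heven : ∀ I : Finset (Fin (2 * k)), Even I.card → (3 : ℤ) ∣ 2 * ∏ i ∈ I, N i + 1 := by
    intro I hI
    have := two_mul_prod_add_one_modEq I hN3
    rw [Finset.prod_const, hI.neg_one_pow] at this
    exact (Int.ModEq.dvd_iff this).2 (by norm_num)
  have hprod5 : ∏ j, N j ≡ 1 [ZMOD 5] := by
    have := prod_modEq_prod Finset.univ hN5
    rwa [Finset.prod_const_one] at this
  refine ⟨fun I hI => ⟨fun h1 => ?_, fun ⟨h1, h2⟩ => ?_⟩, fun i hdvd => ?_,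
    hgcd 3 _ (by norm_num) hM3 (heven _ (by simp)), hgcd 5 _ (by norm_num) hM5 ?_⟩
  · have hodd : Odd I.card := by
      by_contra hcon
      have := hgcd 3 _ (by norm_num) hM3 (heven I (Nat.not_odd_iff_even.1 hcon))
      omega
    have hnk : ¬ Kills (M : ℤ) a I := fun hK => by
      obtain ⟨p, hp, hpM, hpa⟩ := hK.congr dvd_rfl hN
      have := hgcd p _ hp.one_lt hpM hpa
      omega
    have hcard : I.card = k := by
      by_contra hne
      obtain ⟨j, hj, hS⟩ := exists_scheduled_of_card_lt (X := 2 * c ^ 2) (by positivity)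
        (fun i => ((2 * k : ℕ) : ℤ) * x i - ∑ i, x i) hodd (lt_of_le_of_ne hI hne)
      exact hnk (hK j hj I hS)
    refine ⟨hcard, ?_⟩
    by_contra hne
    have hsum : ∑ i ∈ I, (((2 * k : ℕ) : ℤ) * x i - ∑ i, x i) =
        k * (2 * ∑ i ∈ I, x i - ∑ i, x i) := by
      rw [Finset.sum_sub_distrib, ← Finset.mul_sum, Finset.sum_const, hcard]
      push_cast
      ring
    have hk0 : (0 : ℤ) < k := by exact_mod_cast hk.pos
    have hz : ∑ i ∈ I, (((2 * k : ℕ) : ℤ) * x i - ∑ i, x i) ≠ 0 := by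
      rw [hsum]
      refine mul_ne_zero hk0.ne' fun h0 => hne ?_
      have h2 : (2 * ∑ i ∈ I, (x i : ℚ) - ∑ i, (x i : ℚ)) = 0 := by exact_mod_cast h0
      linarith
    have hsplit : 2 * ∑ i ∈ I, x i - ∑ i, x i = ∑ i ∈ I, x i + ∑ i ∈ Iᶜ, -x i := by
      rw [Finset.sum_neg_distrib, ← Finset.sum_add_sum_compl I x]
      ring
    -- The left side is a signed sum Σ ±x_i; |v| ≤ v² for integers leads to the sum of squares,
    -- which is easily computed.
    have habs : |2 * ∑ i ∈ I, x i - ∑ i, x i| ≤ ∑ i, x i * x i := by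
      have h3 : ∀ v : ℤ, |v| ≤ v * v := fun v => by
        rcases eq_or_ne v 0 with rfl | hv
        · simp
        · rw [← abs_mul_abs_self]
          exact le_mul_of_one_le_left (abs_nonneg _) (Int.one_le_abs hv)
      rw [hsplit, ← Finset.sum_add_sum_compl I fun i => x i * x i]
      refine (abs_add_le _ _).trans (add_le_add ?_ ?_)
      · exact (Finset.abs_sum_le_sum_abs _ _).trans (Finset.sum_le_sum fun i _ => h3 _)
      · exact (Finset.abs_sum_le_sum_abs _ _).trans
          (Finset.sum_le_sum fun i _ => by rw [abs_neg]; exact h3 _)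
    have hzc : (∑ i ∈ I, (((2 * k : ℕ) : ℤ) * x i - ∑ i, x i)).natAbs < 2 ^ c := by
      rw [← Int.ofNat_lt, Int.natCast_natAbs, hsum, Nat.cast_pow, Nat.cast_ofNat, abs_mul, abs_of_pos hk0]
      exact (mul_le_mul_of_nonneg_left habs hk0.le).trans_lt hV
    obtain ⟨j, hj, hS⟩ := exists_scheduled_of_sum_ne_zero hk hc hcard hz hzc
    exact hnk (hK j hj I hS)
  · refine Int.isCoprime_iff_gcd_eq_one.1 (Int.isCoprime_of_modEq
      (two_mul_prod_add_one_modEq I hN) (hA.survive I h1 ?_))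
    have h3 : 2 * ∑ i ∈ I, (x i : ℚ) - ∑ i, (x i : ℚ) = 0 := by rw [h2]; ring
    have h4 : 2 * ∑ i ∈ I, x i - ∑ i, x i = 0 := by exact_mod_cast h3
    rw [Finset.sum_sub_distrib, ← Finset.mul_sum, Finset.sum_const, h1]
    push_cast
    linear_combination (k : ℤ) * h4
  -- 5 divides N i − 1, whereas 4∏N j ≡ 4 modulo 5.
  · have h1 : (5 : ℤ) ∣ N i - 1 := Int.modEq_iff_dvd.1 (hN5 i).symm
    have h2 := (Int.ModEq.dvd_iff (hprod5.mul_left 4)).1 (h1.trans hdvd)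
    norm_num at h2
  · exact (Int.ModEq.dvd_iff ((hprod5.mul_left 4).add_right 1)).2 (by norm_num)

end Moduli

/-! ### Bit lengths and the cost of expressions. -/

namespace RAM

theorem bitLen_pos (z : ℤ) : 1 ≤ bitLen z := Nat.le_add_left 1 _

theorem bitLen_le_of_natAbs_lt {z : ℤ} {b : ℕ} (h : z.natAbs < 2 ^ b) : bitLen z ≤ b + 1 :=
  Nat.succ_le_succ (Nat.size_le.2 h)

theorem natAbs_lt_two_pow_bitLen (z : ℤ) : z.natAbs < 2 ^ (bitLen z - 1) :=
  Nat.lt_size_self _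

theorem bitLen_le_of_natAbs_le {u v : ℤ} (h : u.natAbs ≤ v.natAbs) : bitLen u ≤ bitLen v :=
  Nat.succ_le_succ (Nat.size_le_size h)

theorem bitLen_mul_le (u v : ℤ) : bitLen (u * v) ≤ bitLen u + bitLen v := by
  have h : (u * v).natAbs < 2 ^ ((bitLen u - 1) + (bitLen v - 1)) := by
    rw [Int.natAbs_mul, pow_add]
    exact Nat.mul_lt_mul'' (natAbs_lt_two_pow_bitLen u) (natAbs_lt_two_pow_bitLen v)
  have := bitLen_le_of_natAbs_lt h
  have := bitLen_pos u
  omega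

theorem bitLen_le_add_of_natAbs_le {w u v : ℤ} (h : w.natAbs ≤ u.natAbs + v.natAbs) :
    bitLen w ≤ bitLen u + bitLen v := by
  have hu := natAbs_lt_two_pow_bitLen u
  have hv := natAbs_lt_two_pow_bitLen v
  have h1 : w.natAbs < 2 ^ ((bitLen u - 1) + (bitLen v - 1) + 1) := by
    have h2 : 2 ^ (bitLen u - 1) ≤ 2 ^ ((bitLen u - 1) + (bitLen v - 1)) :=
      Nat.pow_le_pow_right (by norm_num) (by omega)
    have h3 : 2 ^ (bitLen v - 1) ≤ 2 ^ ((bitLen u - 1) + (bitLen v - 1)) :=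
      Nat.pow_le_pow_right (by norm_num) (by omega)
    rw [pow_succ]
    omega
  have := bitLen_le_of_natAbs_lt h1
  have := bitLen_pos u
  have := bitLen_pos v
  omega

theorem bitLen_ediv_le (u v : ℤ) : bitLen (u / v) ≤ bitLen u :=
  bitLen_le_of_natAbs_le (Int.natAbs_ediv_le_natAbs u v)

theorem natAbs_emod_le (u v : ℤ) : (u % v).natAbs ≤ u.natAbs + v.natAbs := by
  rcases eq_or_ne v 0 with rfl | hv
  · simp
  · have h1 := Int.emod_nonneg u hv
    have h2 := Int.emod_lt_abs u hv
    rw [Int.abs_eq_natAbs] at h2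
    omega

/-- Since no operation does worse than add bit lengths, a fixed expression has values of length
linear in the memory bound and a cost quadratic in it. -/
theorem Op.bitLen_eval_le (o : Op) (u v : ℤ) : bitLen (o.eval u v) ≤ bitLen u + bitLen v := by
  cases o with
  | add => exact bitLen_le_add_of_natAbs_le (Int.natAbs_add_le u v)
  | sub => exact bitLen_le_add_of_natAbs_le (Int.natAbs_sub_le u v)
  | mul => exact bitLen_mul_le u v
  | div => exact (bitLen_ediv_le u v).trans (Nat.le_add_right _ _)
  | mod => exact bitLen_le_add_of_natAbs_le (natAbs_emod_le u v)

theorem bitLen_natCast_le (n : ℕ) : bitLen (n : ℤ) ≤ n + 1 :=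
  bitLen_le_of_natAbs_lt (by simpa using Nat.lt_two_pow_self)

/-- All numbers in memory have bit length at most `B`. -/
def State.Bdd (B : ℕ) (s : State) : Prop :=
  (∀ x, bitLen (s.reg x) ≤ B) ∧ ∀ a i, bitLen (s.arr a i) ≤ B

/-- In a memory bounded by `B`, the value of `e` has bit length at most `e.width * B`. -/
def Exp.width : Exp → ℕ
  | .const c => bitLen c
  | .reg _ => 1
  | .read _ _ => 1
  | .op _ e f => e.width + f.width

/-- In a memory bounded by `B`, the evaluation of `e` costs at most `e.weight * B ^ 2`. -/
def Exp.weight : Exp → ℕ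
  | .const c => bitLen c
  | .reg _ => 1
  | .read _ i => i.weight + i.width + 1
  | .op _ e f => e.weight + f.weight + e.width * f.width

theorem Exp.bitLen_eval_le {B : ℕ} (hB : 1 ≤ B) {s : State} (hs : s.Bdd B) (e : Exp) :
    bitLen (e.eval s) ≤ e.width * B := by
  induction e with
  | const c => exact Nat.le_mul_of_pos_right _ hB
  | reg x => simpa [Exp.width, Exp.eval] using hs.1 x
  | read a i ih => simpa [Exp.width, Exp.eval] using hs.2 a _
  | op o e f ihe ihf =>
    rw [Exp.width, add_mul]
    exact (Op.bitLen_eval_le o _ _).trans (add_le_add ihe ihf)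

theorem Exp.cost_le {B : ℕ} (hB : 1 ≤ B) {s : State} (hs : s.Bdd B) (e : Exp) :
    e.cost s ≤ e.weight * B ^ 2 := by
  have hBB : B ≤ B ^ 2 := Nat.le_self_pow (by norm_num) B
  induction e with
  | const c => exact Nat.le_mul_of_pos_right _ (by positivity)
  | reg x => simpa [Exp.weight, Exp.cost] using (hs.1 x).trans hBB
  | read a i ih =>
    have h1 := Exp.bitLen_eval_le hB hs i
    have h2 := hs.2 a (i.eval s)
    have h3 := Nat.mul_le_mul_left i.width hBB
    simp only [Exp.weight, Exp.cost, add_mul, one_mul]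
    omega
  | op o e f ihe ihf =>
    have h1 := Nat.mul_le_mul (Exp.bitLen_eval_le hB hs e) (Exp.bitLen_eval_le hB hs f)
    rw [show e.width * B * (f.width * B) = e.width * f.width * B ^ 2 by ring] at h1
    simp only [Exp.weight, Exp.cost, add_mul]
    omega

theorem State.Bdd.setReg {B : ℕ} {s : State} (hs : s.Bdd B) (x : ℕ) {v : ℤ}
    (hv : bitLen v ≤ B) : (s.setReg x v).Bdd B := by
  refine ⟨fun y => ?_, hs.2⟩
  rcases eq_or_ne y x with rfl | h
  · simpa [State.setReg] using hv
  · simpa [State.setReg, h] using hs.1 y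

theorem State.Bdd.setArr {B : ℕ} {s : State} (hs : s.Bdd B) (a : ℕ) (i : ℤ) {v : ℤ}
    (hv : bitLen v ≤ B) : (s.setArr a i v).Bdd B := by
  refine ⟨hs.1, fun a' i' => ?_⟩
  rcases eq_or_ne a' a with rfl | h
  · rcases eq_or_ne i' i with rfl | h'
    · simpa [State.setArr] using hv
    · simpa [State.setArr, h'] using hs.2 a' i'
  · simpa [State.setArr, h] using hs.2 a' i'

/-! ### Counting instructions, and rules for reasoning about programs. -/

/-- `Steps B p s n s'`: started in `s`, the program `p` halts in `s'` after `n` instructions, and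
every number it writes to memory has bit length at most `B`. -/
inductive Steps (B : ℕ) : Prog → State → ℕ → State → Prop where
  | skip (s : State) : Steps B .skip s 1 s
  | assign (s : State) (x : ℕ) (e : Exp) :
      bitLen (e.eval s) ≤ B → Steps B (.assign x e) s 1 (s.setReg x (e.eval s))
  | store (s : State) (a : ℕ) (i e : Exp) :
      bitLen (e.eval s) ≤ B → Steps B (.store a i e) s 1 (s.setArr a (i.eval s) (e.eval s))
  | seq {p q : Prog} {s s₁ s₂ : State} {n₁ n₂ : ℕ} :
      Steps B p s n₁ s₁ → Steps B q s₁ n₂ s₂ → Steps B (.seq p q) s (n₁ + n₂) s₂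
  | loop_exit {e : Exp} {p : Prog} {s : State} :
      ¬ 0 < e.eval s → Steps B (.loop e p) s 1 s
  | loop_step {e : Exp} {p : Prog} {s s₁ s₂ : State} {n₁ n₂ : ℕ} :
      0 < e.eval s → Steps B p s n₁ s₁ → Steps B (.loop e p) s₁ n₂ s₂ →
        Steps B (.loop e p) s (1 + n₁ + n₂) s₂

/-- In a memory bounded by `B`, one instruction of `p` costs at most `p.weight * B ^ 2`. -/
def Prog.weight : Prog → ℕ
  | .skip => 1
  | .assign _ e => e.weight + 1
  | .store _ i e => i.weight + e.weight + i.width + 1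
  | .seq p q => p.weight + q.weight
  | .branch e p q => e.weight + 1 + p.weight + q.weight
  | .loop e p => e.weight + 1 + p.weight

theorem exec_loop_of_not_pos {e : Exp} {p : Prog} {s : State} (h : ¬ 0 < e.eval s) :
    Exec (.loop e p) s (e.cost s + 1) s := by
  constructor
  exact h

/-- The weight is a constant of the program text, so a polynomial number of instructions on numbers
of polynomial length costs polynomial time. `Steps` has no rule for `branch`, which the algorithm
does not use. -/
theorem Steps.exec {B : ℕ} (hB : 1 ≤ B) {p : Prog} {s s' : State} {n : ℕ}
    (h : Steps B p s n s') (hs : s.Bdd B) :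
    s'.Bdd B ∧ ∃ t ≤ n * (p.weight * B ^ 2), Exec p s t s' := by
  have hBB : B ≤ B ^ 2 := Nat.le_self_pow (by norm_num) B
  induction h with
  | skip s => exact ⟨hs, 1, by simpa [Prog.weight] using hB.trans hBB, .skip s⟩
  | assign s x e hv =>
    refine ⟨hs.setReg x hv, _, ?_, .assign s x e⟩
    have := Exp.cost_le hB hs e
    simp only [Prog.weight, add_mul, one_mul]
    omega
  | store s a i e hv =>
    refine ⟨hs.setArr a _ hv, _, ?_, .store s a i e⟩
    have h1 := Exp.cost_le hB hs e
    have h2 := Exp.cost_le hB hs i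
    have h3 := Exp.bitLen_eval_le hB hs i
    have h4 := Nat.mul_le_mul_left i.width hBB
    simp only [Prog.weight, add_mul, one_mul]
    omega
  | @seq p q s s₁ s₂ n₁ n₂ _ _ ih₁ ih₂ =>
    obtain ⟨hs₁, t₁, ht₁, he₁⟩ := ih₁ hs
    obtain ⟨hs₂, t₂, ht₂, he₂⟩ := ih₂ hs₁
    refine ⟨hs₂, t₁ + t₂, ?_, .seq he₁ he₂⟩
    calc t₁ + t₂ ≤ n₁ * (p.weight * B ^ 2) + n₂ * (q.weight * B ^ 2) := add_le_add ht₁ ht₂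
      _ ≤ n₁ * ((p.weight + q.weight) * B ^ 2) + n₂ * ((p.weight + q.weight) * B ^ 2) := by
        gcongr <;> omega
      _ = _ := by rw [Prog.weight]; ring
  | @loop_exit e p s he =>
    refine ⟨hs, _, ?_, exec_loop_of_not_pos he⟩
    have := Exp.cost_le hB hs e
    have h1 : 1 ≤ B ^ 2 := hB.trans hBB
    simp only [Prog.weight, add_mul, one_mul]
    omega
  | @loop_step e p s s₁ s₂ n₁ n₂ he _ _ ih₁ ih₂ =>
    obtain ⟨hs₁, t₁, ht₁, he₁⟩ := ih₁ hs
    obtain ⟨hs₂, t₂, ht₂, he₂⟩ := ih₂ hs₁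
    refine ⟨hs₂, _, ?_, .loop_step he he₁ he₂⟩
    have hc := Exp.cost_le hB hs e
    have h1 : 1 ≤ B ^ 2 := hB.trans hBB
    calc e.cost s + 1 + t₁ + t₂
        ≤ e.weight * B ^ 2 + B ^ 2 + n₁ * (p.weight * B ^ 2) +
          n₂ * ((e.weight + 1 + p.weight) * B ^ 2) := by
            rw [Prog.weight] at ht₂; omega
      _ ≤ (e.weight + 1 + p.weight) * B ^ 2 + n₁ * ((e.weight + 1 + p.weight) * B ^ 2) +
          n₂ * ((e.weight + 1 + p.weight) * B ^ 2) := by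
            have h2 : p.weight ≤ e.weight + 1 + p.weight := by omega
            have h3 := Nat.mul_le_mul_left n₁ (Nat.mul_le_mul_right (B ^ 2) h2)
            have h4 : e.weight * B ^ 2 + B ^ 2 ≤ (e.weight + 1 + p.weight) * B ^ 2 := by
              simp only [add_mul, one_mul]; omega
            omega
      _ = _ := by rw [Prog.weight]; ring

/-- Started in `s`, the program `p` halts after at most `n` instructions in a state with
property `Q`, writing only numbers of bit length at most `B`. -/
def Run (B : ℕ) (p : Prog) (s : State) (n : ℕ) (Q : State → Prop) : Prop :=
  ∃ m ≤ n, ∃ s', Steps B p s m s' ∧ Q s'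

/-- Sequential composition of a list of programs. -/
def block : List Prog → Prog
  | [] => .skip
  | p :: ps => .seq p (block ps)

variable {B n n₁ n₂ : ℕ} {p q : Prog} {ps : List Prog} {s : State} {Q R : State → Prop}

theorem Run.mono (h : Run B p s n₁ Q) (hn : n₁ ≤ n₂) (hQ : ∀ s', Q s' → R s') :
    Run B p s n₂ R := by
  obtain ⟨m, hm, s', hs, hq⟩ := h
  exact ⟨m, hm.trans hn, s', hs, hQ s' hq⟩

theorem Run.le (h : Run B p s n₁ Q) (hn : n₁ ≤ n₂) : Run B p s n₂ Q := h.mono hn fun _ => id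

theorem Run.nil (h : Q s) : Run B (block []) s 1 Q := ⟨1, le_rfl, s, .skip s, h⟩

/-- The postcondition of the first instruction is the claim about the remaining ones, so that proofs
follow the program text. -/
theorem Run.cons (h : Run B p s n₁ fun s' => Run B (block ps) s' n₂ Q) :
    Run B (block (p :: ps)) s (n₁ + n₂) Q := by
  obtain ⟨m, hm, s', hs, m', hm', s'', hs', hq⟩ := h
  exact ⟨m + m', add_le_add hm hm', s'', .seq hs hs', hq⟩

theorem Run.assign {x : ℕ} {e : Exp} (v : ℤ) (hv : e.eval s = v) (hB : bitLen v ≤ B)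
    (h : Run B (block ps) (s.setReg x v) n Q) :
    Run B (block (.assign x e :: ps)) s (1 + n) Q :=
  .cons ⟨1, le_rfl, _, .assign s x e (hv ▸ hB), hv ▸ h⟩

theorem Run.store {a : ℕ} {i e : Exp} (w v : ℤ) (hw : i.eval s = w) (hv : e.eval s = v)
    (hB : bitLen v ≤ B) (h : Run B (block ps) (s.setArr a w v) n Q) :
    Run B (block (.store a i e :: ps)) s (1 + n) Q :=
  .cons ⟨1, le_rfl, _, .store s a i e (hv ▸ hB), hw ▸ hv ▸ h⟩

/-- A loop with an invariant that carries an upper bound for the number of remaining rounds. -/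
theorem Run.loop {e : Exp} {T N : ℕ} (Inv : ℕ → State → Prop) (h0 : Inv N s)
    (hstep : ∀ i s, Inv i s → 0 < e.eval s → ∃ i', i = i' + 1 ∧ Run B p s T (Inv i'))
    (hexit : ∀ i s, Inv i s → ¬ 0 < e.eval s → Q s) :
    Run B (.loop e p) s (N * (T + 1) + 1) Q := by
  induction N generalizing s with
  | zero =>
    have he : ¬ 0 < e.eval s := fun he => by
      obtain ⟨i', hi', -⟩ := hstep 0 s h0 he
      omega
    exact ⟨1, by omega, s, .loop_exit he, hexit 0 s h0 he⟩
  | succ N ih =>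
    by_cases he : 0 < e.eval s
    · obtain ⟨i', hi', m, hm, s₁, hs₁, hI⟩ := hstep _ s h0 he
      obtain rfl : N = i' := by omega
      obtain ⟨m', hm', s₂, hs₂, hq⟩ := ih hI
      refine ⟨_, ?_, s₂, .loop_step he hs₁ hs₂, hq⟩
      rw [add_mul]
      omega
    · exact ⟨1, by omega, s, .loop_exit he, hexit _ s h0 he⟩

theorem State.setReg_reg (s : State) (x y : ℕ) (v : ℤ) :
    (s.setReg x v).reg y = if y = x then v else s.reg y := by
  simp [State.setReg, Function.update_apply]

theorem State.setReg_arr (s : State) (x : ℕ) (v : ℤ) : (s.setReg x v).arr = s.arr := rfl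

theorem State.setArr_reg (s : State) (a : ℕ) (i v : ℤ) : (s.setArr a i v).reg = s.reg := rfl

theorem State.setArr_arr (s : State) (a b : ℕ) (i j v : ℤ) :
    (s.setArr a i v).arr b j = if b = a ∧ j = i then v else s.arr b j := by
  by_cases h : b = a
  · subst h; simp [State.setArr, Function.update_apply]
  · simp [State.setArr, h]

/-- `s'` differs from `s` at most in the registers listed in `R`. -/
def Frame (R : List ℕ) (s s' : State) : Prop :=
  s'.arr = s.arr ∧ ∀ x, x ∉ R → s'.reg x = s.reg x

theorem Frame.refl (R : List ℕ) (s : State) : Frame R s s := ⟨rfl, fun _ _ => rfl⟩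

theorem Frame.setReg {R : List ℕ} {s s' : State} (h : Frame R s s') {x : ℕ} (hx : x ∈ R) (v : ℤ) :
    Frame R s (s'.setReg x v) := by
  refine ⟨h.1, fun y hy => ?_⟩
  rw [State.setReg_reg, if_neg (by rintro rfl; exact hy hx), h.2 y hy]

theorem Frame.trans {R R' : List ℕ} {s s' s'' : State} (h : Frame R s s') (h' : Frame R' s' s'')
    (hR : R' ⊆ R) : Frame R s s'' :=
  ⟨h'.1.trans h.1, fun x hx => (h'.2 x fun hx' => hx (hR hx')).trans (h.2 x hx)⟩

end RAM

/-! ### Subroutines: powers of 2, extended Euclid, removal of common factors, Chinese remaindering.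
-/

namespace RAM

instance : Add Exp := ⟨.op .add⟩
instance : Sub Exp := ⟨.op .sub⟩
instance : Mul Exp := ⟨.op .mul⟩
instance : Div Exp := ⟨.op .div⟩
instance : Mod Exp := ⟨.op .mod⟩

section Eval
variable (s : State) (e f : Exp)
theorem Exp.eval_add : (e + f).eval s = e.eval s + f.eval s := rfl
theorem Exp.eval_sub : (e - f).eval s = e.eval s - f.eval s := rfl
theorem Exp.eval_mul : (e * f).eval s = e.eval s * f.eval s := rfl
theorem Exp.eval_div : (e / f).eval s = e.eval s / f.eval s := rfl
theorem Exp.eval_mod : (e % f).eval s = e.eval s % f.eval s := rfl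
theorem Exp.eval_const (c : ℤ) : (Exp.const c).eval s = c := rfl
theorem Exp.eval_reg (x : ℕ) : (Exp.reg x).eval s = s.reg x := rfl
theorem Exp.eval_read (a : ℕ) : (Exp.read a e).eval s = s.arr a (e.eval s) := rfl
end Eval

/-- Register 14 becomes `2` to the power of register 13. -/
def pow2 : Prog :=
  block [.assign 14 (.const 1),
    .loop (.reg 13) (block [.assign 14 (.reg 14 * .const 2), .assign 13 (.reg 13 - .const 1)])]

/-- For `L` in register 15 and `m` in register 16, register 17 becomes `gcd L m` and register 20
becomes `w` with `w * L ≡ gcd L m` modulo `m`. -/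
def egcd : Prog :=
  block [.assign 18 (.reg 16), .assign 19 (.reg 15 % .reg 16), .assign 20 (.const 0),
    .assign 21 (.const 1),
    .loop (.reg 19) (block [.assign 22 (.reg 18 / .reg 19), .assign 17 (.reg 18 % .reg 19),
      .assign 18 (.reg 19), .assign 19 (.reg 17),
      .assign 17 ((.reg 20 - .reg 22 * .reg 21) % .reg 16),
      .assign 20 (.reg 21), .assign 21 (.reg 17)]),
    .assign 17 (.reg 18)]

/-- Register 16 is divided by its common factors with register 15 until none is left. -/
def removeCommon : Prog :=
  block [.assign 17 (.const 2),
    .loop (.reg 17 - .const 1) (block [egcd, .assign 16 (.reg 16 / .reg 17)])]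

/-- The residues in array 1 are extended from the modulus in register 24 to its product with
register 16. -/
def updateResidues : Prog :=
  block [.assign 23 (.const 0),
    .loop (.reg 0 - .reg 23) (block [
      .assign 13 ((.reg 11 + .reg 12 * .reg 10 * (.reg 0 * .read 0 (.reg 23) - .reg 2)) % .reg 7),
      pow2,
      .store 1 (.reg 23) ((.read 1 (.reg 23) +
        .reg 15 * ((.const 0 - .reg 14 - .read 1 (.reg 23)) * .reg 20)) % (.reg 24 * .reg 16)),
      .assign 23 (.reg 23 + .const 1)])]

variable {B n : ℕ} {s : State}

theorem bitLen_two_pow_le (n : ℕ) : bitLen (2 ^ n) ≤ n + 2 :=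
  bitLen_le_of_natAbs_lt (by
    rw [Int.natAbs_pow]
    exact Nat.pow_lt_pow_right (by norm_num) (Nat.lt_succ_self n))

theorem run_pow2 (hn : s.reg 13 = n) (hB : n + 2 ≤ B) :
    Run B pow2 s (4 * n + 3) fun s' => Frame [13, 14] s s' ∧ s'.reg 14 = 2 ^ n := by
  unfold pow2
  apply Run.le
  · refine Run.assign 1 rfl ((bitLen_two_pow_le 0).trans (by omega)) (Run.cons (n₂ := 1) (Run.loop
      (N := n) (T := 3) (fun i s' => Frame [13, 14] s s' ∧ s'.reg 13 = i ∧
        ∃ t, t + i = n ∧ s'.reg 14 = 2 ^ t) ?_ ?_ ?_))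
    · exact ⟨(Frame.refl _ _).setReg (by simp) _, by simpa [State.setReg_reg] using hn,
        0, by simp, by simp [State.setReg_reg]⟩
    · rintro i s' ⟨hF, h13, t, ht, h14⟩ he
      rw [Exp.eval_reg, h13] at he
      obtain ⟨i, rfl⟩ : ∃ i', i = i' + 1 := ⟨i - 1, by omega⟩
      refine ⟨i, rfl, ?_⟩
      refine Run.le (n₁ := 1 + (1 + 1)) ?_ (by norm_num)
      refine Run.assign (2 ^ (t + 1)) ?_ ?_ (Run.assign i ?_ ?_ (Run.nil ⟨?_, ?_, t + 1, ?_, ?_⟩))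
      · simp only [Exp.eval_mul, Exp.eval_reg, Exp.eval_const, h14, pow_succ]
      · exact (bitLen_two_pow_le _).trans (by omega)
      · simp [Exp.eval_sub, Exp.eval_reg, Exp.eval_const, State.setReg_reg, h13]
      · exact (bitLen_natCast_le i).trans (by omega)
      · exact (hF.setReg (by simp) _).setReg (by simp) _
      · simp [State.setReg_reg]
      · omega
      · simp [State.setReg_reg]
    · rintro i s' ⟨hF, h13, t, ht, h14⟩ he
      rw [Exp.eval_reg, h13] at he
      obtain rfl : i = 0 := by omega
      exact Run.nil ⟨hF, by rw [h14, ← ht, add_zero]⟩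
  · omega

/-- Each division step at least halves the product uv of consecutive remainders, as 2(u mod v) ≤ u;
it starts below 2^(2D). The cofactors matter only through aL ≡ u and cL ≡ v modulo m, so they are
reduced modulo m and never outgrow it. -/
theorem run_egcd {L m : ℤ} {D : ℕ} (hL : s.reg 15 = L) (hm : s.reg 16 = m) (hm0 : 0 < m)
    (hmB : bitLen m ≤ B) (hmD : m < 2 ^ D) :
    Run B egcd s (20 * D + 10) fun s' => Frame [17, 18, 19, 20, 21, 22] s s' ∧
      s'.reg 17 = Int.gcd L m ∧ s'.reg 20 * L ≡ Int.gcd L m [ZMOD m] ∧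
      (s'.reg 20).natAbs ≤ m.natAbs := by
  have hle : ∀ v : ℤ, v.natAbs ≤ m.natAbs → bitLen v ≤ B := fun v hv =>
    (bitLen_le_of_natAbs_le hv).trans hmB
  unfold egcd
  apply Run.le
  · refine Run.assign m (by rw [Exp.eval_reg, hm]) hmB (Run.assign (L % m) (by
      simp [Exp.eval_mod, Exp.eval_reg, State.setReg_reg, hL, hm]) (hle _ ?_) (Run.assign 0 rfl
      (hle _ (by simp)) (Run.assign 1 rfl (hle _ (by omega)) (Run.cons (n₂ := 1 + 1) (Run.loop
      (N := 2 * D) (T := 8) (fun i s' => Frame [17, 18, 19, 20, 21, 22] s s' ∧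
        ∃ u v a c : ℤ, s'.reg 18 = u ∧ s'.reg 19 = v ∧ s'.reg 20 = a ∧ s'.reg 21 = c ∧
          0 ≤ v ∧ v < u ∧ u ≤ m ∧ a.natAbs ≤ m.natAbs ∧ c.natAbs ≤ m.natAbs ∧
          a * L ≡ u [ZMOD m] ∧ c * L ≡ v [ZMOD m] ∧ Int.gcd u v = Int.gcd L m ∧
          u * v < 2 ^ i) ?_ ?_ ?_)))))
    · have h1 := Int.emod_nonneg L hm0.ne'
      have h2 := Int.emod_lt_of_pos L hm0
      omega
    · have h1 := Int.emod_nonneg L hm0.ne'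
      have h2 := Int.emod_lt_of_pos L hm0
      refine ⟨((((Frame.refl _ s).setReg (by simp) _).setReg (by simp) _).setReg (by simp) _).setReg
        (by simp) _, m, L % m, 0, 1, ?_, ?_, ?_, ?_, h1, h2, le_rfl, by simp, by omega, ?_, ?_,
        ?_, ?_⟩
      · simp [State.setReg_reg]
      · simp [State.setReg_reg]
      · simp [State.setReg_reg]
      · simp [State.setReg_reg]
      · exact (Int.modEq_iff_dvd.2 (by simp))
      · simp [Int.ModEq]
      · rw [Int.gcd_comm m, Int.gcd_emod]
      · rw [two_mul, pow_add]
        exact mul_lt_mul'' hmD (h2.trans hmD) hm0.le h1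
    · rintro i s' ⟨hF, u, v, a, c, h18, h19, h20, h21, hv0, hvu, hum, ha, hc, hau, hcv, hg, hi⟩ he
      rw [Exp.eval_reg, h19] at he
      have hm' : s'.reg 16 = m := by rw [hF.2 16 (by simp), hm]
      have hr0 := Int.emod_nonneg u he.ne'
      have hrv := Int.emod_lt_of_pos u he
      have hq0 : 1 ≤ u / v := (Int.le_ediv_iff_mul_le he).2 (by omega)
      have hdiv := Int.mul_ediv_add_emod u v
      have hru : 2 * (u % v) ≤ u := by nlinarith
      have huv : 0 < u * v := mul_pos (by omega) he
      obtain ⟨i, rfl⟩ : ∃ i', i = i' + 1 := by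
        rcases i with _ | i
        · rw [pow_zero] at hi; omega
        · exact ⟨i, rfl⟩
      have hcm : ((a - u / v * c) % m).natAbs ≤ m.natAbs := by
        have h1 := Int.emod_nonneg (a - u / v * c) hm0.ne'
        have h2 := Int.emod_lt_of_pos (a - u / v * c) hm0
        omega
      refine ⟨i, rfl, ?_⟩
      refine Run.le (n₁ := 1 + (1 + (1 + (1 + (1 + (1 + (1 + 1))))))) ?_ (by norm_num)
      refine Run.assign (u / v) ?_ (hle _ ?_) (Run.assign (u % v) ?_ (hle _ (by omega))
        (Run.assign v ?_ (hle _ (by omega)) (Run.assign (u % v) ?_ (hle _ (by omega))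
        (Run.assign ((a - u / v * c) % m) ?_ (hle _ hcm) (Run.assign c ?_ (hle _ hc)
        (Run.assign ((a - u / v * c) % m) ?_ (hle _ hcm) (Run.nil
        ⟨?_, v, u % v, c, (a - u / v * c) % m, ?_, ?_, ?_, ?_, hr0, hrv, by omega, hc, hcm, hcv,
        ?_, ?_, ?_⟩)))))))
      · simp [Exp.eval_div, Exp.eval_reg, h18, h19]
      · exact (Int.natAbs_ediv_le_natAbs u v).trans (by omega)
      · simp [Exp.eval_mod, Exp.eval_reg, h18, h19, State.setReg_reg]
      · simp [Exp.eval_reg, h19, State.setReg_reg]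
      · simp [Exp.eval_reg, State.setReg_reg]
      · simp [Exp.eval_reg, Exp.eval_mod, Exp.eval_mul, Exp.eval_sub, State.setReg_reg, h20, h21, hm']
      · simp [Exp.eval_reg, State.setReg_reg, h21]
      · simp [Exp.eval_reg, State.setReg_reg]
      · exact ((((((hF.setReg (by simp) _).setReg (by simp) _).setReg (by simp) _).setReg
          (by simp) _).setReg (by simp) _).setReg (by simp) _).setReg (by simp) _
      · simp [State.setReg_reg]
      · simp [State.setReg_reg]
      · simp [State.setReg_reg]
      · simp [State.setReg_reg]
      · have h1 : (a - u / v * c) % m * L ≡ (a - u / v * c) * L [ZMOD m] :=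
          (Int.mod_modEq _ _).mul_right L
        have h2 : (a - u / v * c) * L ≡ u - u / v * v [ZMOD m] := by
          have := hau.sub (hcv.mul_left (u / v))
          rwa [← mul_assoc, ← sub_mul] at this
        rw [show u - u / v * v = u % v by linarith] at h2
        exact h1.trans h2
      · rw [← hg, Int.gcd_comm v, Int.gcd_emod]
      · rw [pow_succ] at hi
        nlinarith
    · rintro i s' ⟨hF, u, v, a, c, h18, h19, h20, h21, hv0, hvu, hum, ha, hc, hau, hcv, hg, hi⟩ he
      rw [Exp.eval_reg, h19] at he
      obtain rfl : v = 0 := by omega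
      rw [Int.gcd_zero_right] at hg
      have hu : u = Int.gcd L m := by omega
      refine Run.assign u (by rw [Exp.eval_reg, h18]) (hle _ (by omega))
        (Run.nil ⟨hF.setReg (by simp) _, ?_, ?_, ?_⟩)
      · simpa [State.setReg_reg] using hu
      · simpa [State.setReg_reg, h20, ← hu] using hau
      · simpa [State.setReg_reg, h20] using ha
  · omega

end RAM

namespace RAM
variable {B : ℕ} {s : State}

/-- A pass with gcd above 1 at least halves m and removes only factors shared with L. The last pass
has gcd 1 and leaves m unchanged; its cofactor is the inverse of L modulo m needed for Chinese
remaindering. -/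
theorem run_removeCommon {L m₀ : ℤ} {D : ℕ} (hL : s.reg 15 = L) (hm₀ : s.reg 16 = m₀)
    (hm₀0 : 0 < m₀) (hmB : bitLen m₀ ≤ B) (hB : 3 ≤ B) (hmD : m₀ < 2 ^ D) :
    Run B removeCommon s (D * (20 * D + 13) + 3) fun s' => Frame [16, 17, 18, 19, 20, 21, 22] s s' ∧
      ∃ m, s'.reg 16 = m ∧ 0 < m ∧ m ∣ m₀ ∧
        (∀ p : ℕ, p.Prime → (p : ℤ) ∣ m₀ → ¬ (p : ℤ) ∣ L → (p : ℤ) ∣ m) ∧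
        s'.reg 20 * L ≡ 1 [ZMOD m] := by
  unfold removeCommon
  apply Run.le
  -- The initial value 2 serves only to enter the loop.
  · refine Run.assign 2 rfl (le_trans (by decide) hB) (Run.cons (n₂ := 1) (Run.loop
      (N := D) (T := 20 * D + 12) (fun i s' => Frame [16, 17, 18, 19, 20, 21, 22] s s' ∧
      ∃ m, s'.reg 16 = m ∧ 0 < m ∧ m ∣ m₀ ∧
        (∀ p : ℕ, p.Prime → (p : ℤ) ∣ m₀ → ¬ (p : ℤ) ∣ L → (p : ℤ) ∣ m) ∧
        (1 < s'.reg 17 ∧ m < 2 ^ i ∨ s'.reg 17 = 1 ∧ s'.reg 20 * L ≡ 1 [ZMOD m])) ?_ ?_ ?_))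
    · exact ⟨(Frame.refl _ s).setReg (by simp) _, m₀, by simpa [State.setReg_reg] using hm₀, hm₀0,
        dvd_rfl, fun p _ h _ => h, Or.inl ⟨by simp [State.setReg_reg], hmD⟩⟩
    · rintro i s₁ ⟨hF, m, h16, hm0, hmm, hp, hor⟩ he
      simp only [Exp.eval_sub, Exp.eval_reg, Exp.eval_const] at he
      obtain ⟨-, hmi⟩ := hor.resolve_right fun h => by omega
      obtain ⟨i, rfl⟩ : ∃ i', i = i' + 1 := by
        rcases i with _ | i
        · rw [pow_zero] at hmi; omega
        · exact ⟨i, rfl⟩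
      refine ⟨i, rfl, ?_⟩
      have hmle := Int.le_of_dvd hm₀0 hmm
      apply Run.le
      · refine Run.cons (n₂ := 1 + 1) ((run_egcd (by rw [hF.2 15 (by simp), hL]) h16 hm0
          ((bitLen_le_of_natAbs_le (by omega)).trans hmB) (hmle.trans_lt hmD)).mono le_rfl ?_)
        rintro s₂ ⟨hF₂, h17, h20, -⟩
        have hg0 : 0 < Int.gcd L m := Int.gcd_pos_of_ne_zero_right _ hm0.ne'
        have hgm : ((Int.gcd L m : ℕ) : ℤ) ∣ m := Int.gcd_dvd_right ..
        obtain ⟨c, hc⟩ := hgm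
        have hg0' : (0 : ℤ) < (Int.gcd L m : ℕ) := by exact_mod_cast hg0
        have hdiv : m / (Int.gcd L m : ℕ) = c :=
          Int.ediv_eq_of_eq_mul_right hg0'.ne' hc
        have hc0 : 0 < c := by
          by_contra hcon
          nlinarith
        have hcm : c ∣ m := Dvd.intro_left _ hc.symm
        have hcle := Int.le_of_dvd hm0 hcm
        refine Run.assign c ?_ ((bitLen_le_of_natAbs_le (by omega)).trans hmB) (Run.nil
          ⟨(hF.trans hF₂ (by simp)).setReg (by simp) _, c, by simp [State.setReg_reg], hc0,
          hcm.trans hmm, ?_, ?_⟩)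
        · simp only [Exp.eval_div, Exp.eval_reg, hF₂.2 16 (by simp), h16, h17, hdiv]
        · intro p hpp hpm hpL
          have h1 := hp p hpp hpm hpL
          rw [hc] at h1
          exact ((Nat.prime_iff_prime_int.1 hpp).dvd_mul.1 h1).resolve_left fun h =>
            hpL (h.trans (Int.gcd_dvd_left ..))
        · simp only [State.setReg_reg, h17]
          norm_num
          rcases Nat.lt_or_ge 1 (Int.gcd L m) with h | h
          · refine Or.inl ⟨h, ?_⟩
            have : (2 : ℤ) ≤ (Int.gcd L m : ℕ) := by exact_mod_cast h
            rw [pow_succ] at hmi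
            nlinarith
          · have h1 : Int.gcd L m = 1 := by omega
            rw [h1] at h20 hc
            refine Or.inr ⟨h1, ?_⟩
            rw [show c = m by rw [hc]; simp]
            exact_mod_cast h20
      · omega
    · rintro i s₁ ⟨hF, m, h16, hm0, hmm, hp, hor⟩ he
      simp only [Exp.eval_sub, Exp.eval_reg, Exp.eval_const] at he
      exact Run.nil ⟨hF, m, h16, hm0, hmm, hp, (hor.resolve_left fun h => by omega).2⟩
  · have : D * (20 * D + 12 + 1) = D * (20 * D + 13) := rfl
    omega

/-- Exponents are reduced modulo d before the power is formed, so 2^e stays below 2^d. -/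
theorem run_updateResidues {n d D : ℕ} {S u σ r L m w M : ℤ} (h0 : s.reg 0 = n) (h2 : s.reg 2 = S)
    (h7 : s.reg 7 = d) (h10 : s.reg 10 = u) (h11 : s.reg 11 = σ) (h12 : s.reg 12 = r)
    (h15 : s.reg 15 = L) (h16 : s.reg 16 = m) (h20 : s.reg 20 = w) (h24 : s.reg 24 = M)
    (hd : 0 < d) (hdD : d ≤ D) (hM : 0 < M * m) (hMB : bitLen (M * m) ≤ B) (hDB : D + 2 ≤ B)
    (hnB : n + 2 ≤ B) :
    Run B updateResidues s (n * (4 * D + 8) + 3) fun s' =>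
      (∀ x, x ∉ [13, 14, 23] → s'.reg x = s.reg x) ∧ s'.arr 0 = s.arr 0 ∧
      ∀ i : ℕ, i < n → s'.arr 1 i = (s.arr 1 i + L * ((0 -
        2 ^ ((σ + r * u * (n * s.arr 0 i - S)) % d).toNat - s.arr 1 i) * w)) % (M * m) := by
  unfold updateResidues
  apply Run.le
  · refine Run.assign 0 rfl (le_trans (by decide) (le_trans (Nat.le_add_left 2 D) hDB))
      (Run.cons (n₂ := 1) (Run.loop (N := n) (T := 4 * D + 7) (fun i s' =>
      (∀ x, x ∉ [13, 14, 23] → s'.reg x = s.reg x) ∧ s'.arr 0 = s.arr 0 ∧ ∃ t : ℕ, t + i = n ∧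
      s'.reg 23 = t ∧ (∀ j : ℕ, t ≤ j → s'.arr 1 j = s.arr 1 j) ∧
      ∀ j : ℕ, j < t → s'.arr 1 j = (s.arr 1 j + L * ((0 -
        2 ^ ((σ + r * u * (n * s.arr 0 j - S)) % d).toNat - s.arr 1 j) * w)) % (M * m)) ?_ ?_ ?_))
    · exact ⟨((Frame.refl [13, 14, 23] s).setReg (by simp) _).2, rfl, 0, by simp,
        by simp [State.setReg_reg], fun _ _ => rfl, fun j hj => absurd hj (by omega)⟩
    · rintro i s₁ ⟨hR, hA, t, ht, h23, hold, hnew⟩ he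
      have g0 : s₁.reg 0 = n := by rw [hR 0 (by simp), h0]
      simp only [Exp.eval_sub, Exp.eval_reg, g0, h23] at he
      obtain ⟨i, rfl⟩ : ∃ i', i = i' + 1 := ⟨i - 1, by omega⟩
      refine ⟨i, rfl, ?_⟩
      set e := (σ + r * u * (n * s.arr 0 t - S)) % d with hedef
      have he0 : 0 ≤ e := Int.emod_nonneg _ (by omega)
      have hed : e < d := Int.emod_lt_of_pos _ (by omega)
      have heB : bitLen e ≤ B := by
        have := bitLen_natCast_le e.toNat
        rw [Int.toNat_of_nonneg he0] at this
        omega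
      set v := (s.arr 1 t + L * ((0 - 2 ^ e.toNat - s.arr 1 t) * w)) % (M * m) with hv
      have hv0 : 0 ≤ v := Int.emod_nonneg _ hM.ne'
      have hvM : v < M * m := Int.emod_lt_of_pos _ hM
      apply Run.le
      · refine Run.assign e ?_ heB (Run.cons (n₂ := 1 + (1 + 1)) ((run_pow2 (n := e.toNat) ?_ ?_).mono
          (n₂ := 4 * D + 3) ?_ ?_))
        · simp only [Exp.eval_mod, Exp.eval_add, Exp.eval_mul, Exp.eval_sub, Exp.eval_reg,
            Exp.eval_read, h23, hA, g0, hR 11 (by simp), hR 12 (by simp), hR 10 (by simp),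
            hR 2 (by simp), hR 7 (by simp), h2, h7, h10, h11, h12, hedef]
        · simp [State.setReg_reg, Int.toNat_of_nonneg he0]
        · omega
        · omega
        · rintro s₂ ⟨hF, h14⟩
          have k0 : ∀ x, x ∉ [13, 14, 23] → s₂.reg x = s.reg x := by
            intro x hx
            rw [hF.2 x (by simp at hx ⊢; tauto), State.setReg_reg, if_neg (by simp at hx; tauto),
              hR x hx]
          have k23 : s₂.reg 23 = t := by
            rw [hF.2 23 (by simp), State.setReg_reg, if_neg (by simp), h23]
          have karr : s₂.arr = s₁.arr := by rw [hF.1, State.setReg_arr]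
          have kold : s₁.arr 1 t = s.arr 1 t := hold t le_rfl
          refine Run.store t v ?_ ?_ ?_ (Run.assign ((t + 1 : ℕ) : ℤ) ?_ ?_ (Run.nil ⟨?_, ?_, t + 1,
            by omega, ?_, ?_, ?_⟩))
          · rw [Exp.eval_reg, k23]
          · simp only [Exp.eval_mod, Exp.eval_add, Exp.eval_mul, Exp.eval_sub, Exp.eval_reg,
              Exp.eval_read, Exp.eval_const, k23, karr, kold, h14, k0 15 (by simp), k0 20 (by simp),
              k0 24 (by simp), k0 16 (by simp), h15, h16, h20, h24, hv]
          · exact (bitLen_le_of_natAbs_le (by omega)).trans hMB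
          · simp [Exp.eval_add, Exp.eval_reg, Exp.eval_const, State.setArr_reg, k23]
          · exact (bitLen_natCast_le _).trans (by omega)
          · intro x hx
            rw [State.setReg_reg, if_neg (by simp at hx; tauto), State.setArr_reg, k0 x hx]
          · funext j
            simp [State.setReg_arr, State.setArr_arr, karr, hA]
          · simp [State.setReg_reg]
          · intro j hj
            simp only [State.setReg_arr, State.setArr_arr, karr]
            rw [if_neg (by omega), hold j (by omega)]
          · intro j hj
            simp only [State.setReg_arr, State.setArr_arr, karr]
            rcases Nat.lt_succ_iff_lt_or_eq.1 hj with h | rfl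
            · rw [if_neg (by omega), hnew j h]
            · simp [hv, hedef]
      · omega
    · rintro i s₁ ⟨hR, hA, t, ht, h23, hold, hnew⟩ he
      have g0 : s₁.reg 0 = n := by rw [hR 0 (by simp), h0]
      simp only [Exp.eval_sub, Exp.eval_reg, g0, h23] at he
      exact Run.nil ⟨hR, hA, fun j hj => hnew j (by omega)⟩
  · have : n * (4 * D + 7 + 1) = n * (4 * D + 8) := rfl
    omega
end RAM

/-! ### One round on the machine. -/

namespace RAM
variable {B : ℕ} {s : State}

/-- One round of the main loop; register 6 holds the number of the round. -/
def round : Prog :=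
  -- Registers 1, 2, 4, 7, 24 hold k, S, X, D, M. Registers 8 to 12 receive l, q, u, s and 1 + ls,
  -- register 7 the new order d, register 15 the number L = (2^(1+ks) − 1)M, and register 16 first
  -- 2^d − 1, then m.
  block [.assign 8 (.reg 6 % .reg 1 + .const 1),
    .assign 9 (.reg 6 / .reg 1 % .reg 4 + .const 1),
    .assign 10 (.reg 6 / (.reg 1 * .reg 4)),
    .assign 11 (.reg 7 / (.reg 9 * .reg 8) + .const 1),
    .assign 12 (.const 1 + .reg 8 * .reg 11),
    .assign 7 (.reg 9 * .reg 12),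
    .assign 13 (.const 1 + .reg 1 * .reg 11),
    pow2,
    .assign 15 ((.reg 14 - .const 1) * .reg 24),
    .assign 13 (.reg 7),
    pow2,
    .assign 16 (.reg 14 - .const 1),
    removeCommon,
    updateResidues,
    .assign 24 (.reg 24 * .reg 16),
    .assign 6 (.reg 6 + .const 1)]

/-- One inverse w of L modulo m serves for Chinese remaindering: the correction L(−p − a)w vanishes
modulo M because M ∣ L, and equals −p − a modulo m because wL ≡ 1. -/
theorem modEq_old_of_update {a a' c L M m : ℤ} (hL : M ∣ L) (h : a' = (a + L * c) % (M * m)) :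
    a' ≡ a [ZMOD M] := by
  rw [h]
  refine ((Int.mod_modEq _ _).of_dvd (Dvd.intro m rfl)).trans ?_
  exact (Int.modEq_iff_dvd.2 (by simpa using hL.mul_right c))

theorem modEq_new_of_update {a a' p L w M m : ℤ} (hw : w * L ≡ 1 [ZMOD m])
    (h : a' = (a + L * ((0 - p - a) * w)) % (M * m)) : a' ≡ -p [ZMOD m] := by
  rw [h]
  refine ((Int.mod_modEq _ _).of_dvd (Dvd.intro_left M rfl)).trans ?_
  have := (hw.mul_left (0 - p - a)).add_left a
  rw [show a + L * ((0 - p - a) * w) = a + (0 - p - a) * (w * L) by ring]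
  rwa [show a + (0 - p - a) * 1 = -p by ring] at this

theorem run_round {k X j D l q u σ d b μ : ℕ} {S M : ℤ} (h0 : s.reg 0 = (2 * k : ℕ))
    (h1 : s.reg 1 = k) (h2 : s.reg 2 = S) (h4 : s.reg 4 = X) (h6 : s.reg 6 = j) (h7 : s.reg 7 = D)
    (h24 : s.reg 24 = M) (hM : 0 < M) (hMμ : M < 2 ^ μ)
    (hl : l = j % k + 1) (hq : q = (j / k) % X + 1) (hu : u = j / (k * X))
    (hσ : σ = D / (q * l) + 1) (hd : d = q * (1 + l * σ))
    (hk : 2 * k + 1 ≤ b) (hX : X + 1 ≤ b) (hj : j + 1 ≤ b) (hdb : μ + d ≤ b)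
    (hf : 1 + k * σ ≤ b) (hB : 2 * b + 3 ≤ B) :
    Run B round s (b * (32 * b + 35) + 40) fun s' =>
      (∀ x, x ∈ [0, 1, 2, 4, 5] → s'.reg x = s.reg x) ∧ s'.arr 0 = s.arr 0 ∧
      s'.reg 6 = (j + 1 : ℕ) ∧ s'.reg 7 = d ∧ ∃ m : ℤ, s'.reg 24 = M * m ∧ m < 2 ^ d ∧
      Round k (fun i : Fin (2 * k) => (2 * k : ℕ) * s.arr 0 i - S) l q u σ M m
        (fun i => s.arr 1 i) fun i => s'.arr 1 i := by
  have hq0 : 0 < q := by omega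
  have hl0 : 0 < l := by omega
  have hd0 : 0 < d := by rw [hd]; positivity
  have hqX : q ≤ b := by
    have : (j / k) % X ≤ X ∨ X = 0 := by
      rcases Nat.eq_zero_or_pos X with h | h
      · exact Or.inr h
      · exact Or.inl (Nat.mod_lt _ h).le
    have := Nat.div_le_self j k
    rcases ‹_ ∨ _› with h | h
    · omega
    · subst h; rw [Nat.mod_zero] at hq; omega
  have hlb : l ≤ b := by have := Nat.mod_le j k; omega
  have hub : u ≤ b := by have := Nat.div_le_self j (k * X); omega
  have hrd : 1 + l * σ ≤ d := by rw [hd]; exact Nat.le_mul_of_pos_left _ hq0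
  have hσb : σ ≤ b := by have := Nat.le_mul_of_pos_left σ hl0; omega
  have small : ∀ v : ℕ, v ≤ b → bitLen (v : ℤ) ≤ B := fun v hv =>
    (bitLen_natCast_le v).trans (by omega)
  have hpd : (2 : ℤ) ^ 1 ≤ 2 ^ d := pow_le_pow_right₀ (by norm_num) hd0
  set L := ((2 : ℤ) ^ (1 + k * σ) - 1) * M with hL
  have hLB : bitLen L ≤ B := by
    refine (bitLen_mul_le _ _).trans ?_
    have e1 : bitLen ((2 : ℤ) ^ (1 + k * σ) - 1) ≤ (1 + k * σ) + 2 := by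
      have e2 : (1 : ℤ) ≤ 2 ^ (1 + k * σ) := one_le_pow₀ (by norm_num)
      exact (bitLen_le_of_natAbs_le (by omega)).trans (bitLen_two_pow_le _)
    have e3 : bitLen M ≤ μ + 1 := bitLen_le_of_natAbs_lt (by
      zify; rwa [abs_of_pos hM])
    omega
  unfold round
  obtain ⟨N₃, hN₃⟩ : ∃ N, N = 2 * k * (4 * d + 8) + 3 + (1 + (1 + 1)) := ⟨_, rfl⟩
  obtain ⟨N₂, hN₂⟩ : ∃ N, N = 1 + (d * (20 * d + 13) + 3 + N₃) := ⟨_, rfl⟩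
  obtain ⟨N₁, hN₁⟩ : ∃ N, N = 1 + (1 + (4 * d + 3 + N₂)) := ⟨_, rfl⟩
  apply Run.le
  · refine Run.assign (l : ℤ) ?_ (small _ hlb) (Run.assign (q : ℤ) ?_ (small _ hqX)
      (Run.assign (u : ℤ) ?_ (small _ hub) (Run.assign (σ : ℤ) ?_ (small _ hσb)
      (Run.assign ((1 + l * σ : ℕ) : ℤ) ?_ (small _ (by omega)) (Run.assign (d : ℤ) ?_
      (small _ (by omega)) (Run.assign ((1 + k * σ : ℕ) : ℤ) ?_ (small _ hf)
      (Run.cons (n₂ := N₁) ((run_pow2 (n := 1 + k * σ) ?_ (by omega)).mono le_rfl ?_))))))))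
    · simp [Exp.eval_add, Exp.eval_mod, Exp.eval_reg, Exp.eval_const, h6, h1, hl]
    · simp [Exp.eval_add, Exp.eval_mod, Exp.eval_div, Exp.eval_reg, Exp.eval_const,
        State.setReg_reg, h6, h1, h4, hq]
    · simp [Exp.eval_mul, Exp.eval_div, Exp.eval_reg, State.setReg_reg, h6, h1, h4, hu]
    · simp [Exp.eval_add, Exp.eval_mul, Exp.eval_div, Exp.eval_reg, Exp.eval_const,
        State.setReg_reg, h7, hσ]
    · simp [Exp.eval_add, Exp.eval_mul, Exp.eval_reg, Exp.eval_const, State.setReg_reg]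
    · simp [Exp.eval_mul, Exp.eval_reg, State.setReg_reg, hd]
    · simp [Exp.eval_add, Exp.eval_mul, Exp.eval_reg, Exp.eval_const, State.setReg_reg, h1]
    · simp [State.setReg_reg]
    rintro s₁ ⟨hF₁, h14⟩
    have r1 : ∀ x, x ∈ [0, 1, 2, 4, 5, 6, 24] → s₁.reg x = s.reg x := by
      intro x hx
      rw [hF₁.2 x (by simp at hx ⊢; omega)]
      simp only [State.setReg_reg]
      simp at hx
      repeat rw [if_neg (by omega)]
    have r7 : s₁.reg 7 = d := by rw [hF₁.2 7 (by simp)]; simp [State.setReg_reg]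
    have r10 : s₁.reg 10 = u := by rw [hF₁.2 10 (by simp)]; simp [State.setReg_reg]
    have r11 : s₁.reg 11 = σ := by rw [hF₁.2 11 (by simp)]; simp [State.setReg_reg]
    have r12 : s₁.reg 12 = (1 + l * σ : ℕ) := by
      rw [hF₁.2 12 (by simp)]; simp [State.setReg_reg]
    have rarr : s₁.arr = s.arr := hF₁.1
    clear hF₁
    rw [hN₁]
    refine Run.assign L ?_ hLB (Run.assign (d : ℤ) ?_ (small _ (by omega)) (Run.cons (n₂ := N₂)
      ((run_pow2 (n := d) ?_ (by omega)).mono le_rfl ?_)))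
    · simp [Exp.eval_mul, Exp.eval_sub, Exp.eval_reg, Exp.eval_const, h14, r1, h24, hL]
    · simp [Exp.eval_reg, State.setReg_reg, r7]
    · simp [State.setReg_reg]
    rintro s₂ ⟨hF₂, h14'⟩
    have hm₀B : bitLen ((2 : ℤ) ^ d - 1) ≤ B :=
      (bitLen_le_of_natAbs_le (by omega)).trans ((bitLen_two_pow_le d).trans (by omega))
    rw [hN₂]
    refine Run.assign (2 ^ d - 1) ?_ hm₀B (Run.cons (n₂ := N₃)
      ((run_removeCommon (L := L) (m₀ := 2 ^ d - 1) (D := d) ?_ ?_ (by omega) hm₀B (by omega)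
        (by omega)).mono le_rfl ?_))
    · simp [Exp.eval_sub, Exp.eval_reg, Exp.eval_const, h14']
    · rw [State.setReg_reg, if_neg (by simp), hF₂.2 15 (by simp)]
      simp [State.setReg_reg]
    · simp [State.setReg_reg]
    rintro s₃ ⟨hF₃, m, h16, hm0, hmd, hfull, hw⟩
    have hmlt : m < 2 ^ d := by have := Int.le_of_dvd (by omega) hmd; omega
    have t : ∀ x, x ∈ [0, 1, 2, 4, 5, 6, 7, 10, 11, 12, 24] → s₃.reg x = s₁.reg x := by
      intro x hx
      rw [hF₃.2 x (by simp at hx ⊢; omega), State.setReg_reg, if_neg (by simp at hx; omega),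
        hF₂.2 x (by simp at hx ⊢; omega), State.setReg_reg, if_neg (by simp at hx; omega),
        State.setReg_reg, if_neg (by simp at hx; omega)]
    have t15 : s₃.reg 15 = L := by
      rw [hF₃.2 15 (by simp), State.setReg_reg, if_neg (by simp), hF₂.2 15 (by simp)]
      simp [State.setReg_reg]
    have tarr : s₃.arr = s.arr := by
      rw [hF₃.1, State.setReg_arr, hF₂.1, State.setReg_arr, State.setReg_arr, rarr]
    have hMm : 0 < M * m := mul_pos hM hm0
    have hMmb : M * m < 2 ^ b := by
      calc M * m < 2 ^ μ * 2 ^ d := mul_lt_mul'' hMμ hmlt hM.le hm0.le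
        _ = 2 ^ (μ + d) := (pow_add _ _ _).symm
        _ ≤ 2 ^ b := pow_le_pow_right₀ (by norm_num) hdb
    have hMmB : bitLen (M * m) ≤ B := by
      have : bitLen (M * m) ≤ b + 1 := bitLen_le_of_natAbs_lt (by
        zify; rwa [abs_of_pos hMm])
      omega
    rw [hN₃]
    refine Run.cons (n₂ := 1 + (1 + 1)) ((run_updateResidues (n := 2 * k) (d := d) (D := d) (S := S)
      (u := u) (σ := σ) (r := (1 + l * σ : ℕ)) (L := L) (m := m) (w := s₃.reg 20) (M := M)
      ?_ ?_ ?_ ?_ ?_ ?_ t15 h16 rfl ?_ hd0 le_rfl hMm hMmB (by omega) (by omega)).mono le_rfl ?_)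
    · rw [t 0 (by simp), r1 0 (by simp), h0]
    · rw [t 2 (by simp), r1 2 (by simp), h2]
    · rw [t 7 (by simp), r7]
    · rw [t 10 (by simp), r10]
    · rw [t 11 (by simp), r11]
    · rw [t 12 (by simp), r12]
    · rw [t 24 (by simp), r1 24 (by simp), h24]
    rintro s₄ ⟨hR₄, hA₄, hnew⟩
    refine Run.assign (M * m) ?_ hMmB (Run.assign ((j + 1 : ℕ) : ℤ) ?_ (small _ hj) (Run.nil
      ⟨?_, ?_, ?_, ?_, m, ?_, hmlt, ?_⟩))
    · simp only [Exp.eval_mul, Exp.eval_reg, hR₄ 24 (by simp), hR₄ 16 (by simp), h16,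
        t 24 (by simp), r1 24 (by simp), h24]
    · simp only [Exp.eval_add, Exp.eval_reg, Exp.eval_const, State.setReg_reg]
      rw [if_neg (by simp), hR₄ 6 (by simp), t 6 (by simp), r1 6 (by simp), h6]
      simp
    · intro x hx
      rw [State.setReg_reg, if_neg (by simp at hx; omega), State.setReg_reg,
        if_neg (by simp at hx; omega), hR₄ x (by simp at hx ⊢; omega),
        t x (by simp at hx ⊢; omega), r1 x (by simp at hx ⊢; omega)]
    · rw [State.setReg_arr, State.setReg_arr, hA₄, tarr]
    · simp [State.setReg_reg]
    · simp [State.setReg_reg, hR₄, t, r7]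
    · simp [State.setReg_reg]
    · have hup : ∀ i : Fin (2 * k), s₄.arr 1 i = (s.arr 1 i + L * ((0 -
          2 ^ (((σ : ℤ) + (1 + l * σ) * u * ((2 * k : ℕ) * s.arr 0 i - S)) %
            (q * (1 + l * σ) : ℕ)).toNat - s.arr 1 i) * s₃.reg 20)) % (M * m) := by
        intro i
        rw [hnew i i.2, tarr, hd]
        push_cast
        rfl
      refine ⟨hm0, hd ▸ hmd, ⟨-(((s₃.reg 20) * L - 1) / m), s₃.reg 20, ?_⟩, hd ▸ hfull, fun i => ?_,
        fun i => ?_⟩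
      -- Writing wL − 1 as a multiple of m is a Bézout identity for m and L.
      · have := Int.ediv_mul_cancel (Int.modEq_iff_dvd.1 hw.symm)
        rw [← hL]
        linear_combination -this
      · exact modEq_old_of_update (Dvd.intro_left _ rfl) (hup i)
      · exact modEq_new_of_update hw (hup i)
  · have e1 : d * (20 * d + 13) ≤ b * (20 * b + 13) := by gcongr <;> omega
    have e2 : 2 * k * (4 * d + 8) ≤ b * (4 * b + 8) := by gcongr <;> omega
    have e3 : b * (32 * b + 35) = b * (20 * b + 13) + b * (4 * b + 8) + b * (8 * b) + 14 * b := by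
      ring
    omega
end RAM

/-! ### Preparation of the main loop, and output. -/

namespace RAM
variable {B : ℕ} {s : State}

/-- Register 2 becomes the sum of the input, register 3 an upper bound for everything that the
moduli have to tell from zero; the residues are initialized to 11. -/
def accumulate : Prog :=
  block [.assign 1 (.reg 0 / .const 2), .assign 3 (.const 1), .assign 23 (.const 0),
    .loop (.reg 0 - .reg 23) (block [
      .assign 2 (.reg 2 + .read 0 (.reg 23)),
      .assign 3 (.reg 3 + .reg 1 * (.read 0 (.reg 23) * .read 0 (.reg 23))),
      .store 1 (.reg 23) (.const 11),
      .assign 23 (.reg 23 + .const 1)])]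

/-- Register 4 becomes `2 * c ^ 2` for an upper bound `c` on the bit length of register 3. -/
def measure : Prog :=
  block [.assign 4 (.const 7),
    .loop (.reg 3) (block [.assign 3 (.reg 3 / .const 2), .assign 4 (.reg 4 + .const 1)]),
    .assign 4 (.const 2 * (.reg 4 * .reg 4)), .assign 5 (.reg 1 * .reg 4 * .reg 4),
    .assign 6 (.const 0), .assign 7 (.reg 1 + .const 6), .assign 24 (.const 15)]

/-- The modulus and the residues are moved to array 0. -/
def output : Prog :=
  block [.assign 23 (.const 0),
    .loop (.reg 0 - .reg 23) (block [.store 0 (.reg 23 + .const 1) (.read 1 (.reg 23)),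
      .assign 23 (.reg 23 + .const 1)]),
    .store 0 (.const 0) (.reg 24), .assign 0 (.reg 0 + .const 1)]

/-- The algorithm. -/
def mainProg : Prog := block [accumulate, measure, .loop (.reg 5 - .reg 6) round, output]

theorem abs_le_mul_self (v : ℤ) : |v| ≤ v * v := by
  rcases eq_or_ne v 0 with rfl | hv
  · simp
  · rw [← abs_mul_abs_self]
    exact le_mul_of_one_le_left (abs_nonneg _) (Int.one_le_abs hv)

/-- The partial sums of the x_i are bounded by those of their squares, so the bound for register 3
covers register 2 as well. -/
theorem run_accumulate {k β : ℕ} {x : ℕ → ℤ} (hk : 0 < k) (h0 : s.reg 0 = (2 * k : ℕ))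
    (h2 : s.reg 2 = 0) (hx : ∀ i : ℕ, s.arr 0 i = x i)
    (hβ : 1 + k * ∑ i ∈ Finset.range (2 * k), x i * x i < 2 ^ β) (hB : β + 1 ≤ B) (hB5 : 5 ≤ B)
    (hkB : 2 * k + 2 ≤ B) :
    Run B accumulate s (2 * k * 6 + 5) fun s' => s'.reg 0 = (2 * k : ℕ) ∧ s'.reg 1 = k ∧
      s'.reg 2 = ∑ i ∈ Finset.range (2 * k), x i ∧
      s'.reg 3 = 1 + k * ∑ i ∈ Finset.range (2 * k), x i * x i ∧ s'.arr 0 = s.arr 0 ∧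
      ∀ i : ℕ, i < 2 * k → s'.arr 1 i = 11 := by
  have hsq : ∀ t ≤ 2 * k, ∑ i ∈ Finset.range t, x i * x i ≤
      ∑ i ∈ Finset.range (2 * k), x i * x i := fun t ht =>
    Finset.sum_le_sum_of_subset_of_nonneg (Finset.range_subset_range.2 ht)
      fun i _ _ => mul_self_nonneg (x i)
  have hsq0 : ∀ t, 0 ≤ ∑ i ∈ Finset.range t, x i * x i := fun t =>
    Finset.sum_nonneg fun i _ => mul_self_nonneg (x i)
  have hk0 : (1 : ℤ) ≤ k := by exact_mod_cast hk
  have hVB : ∀ t ≤ 2 * k, bitLen (1 + k * ∑ i ∈ Finset.range t, x i * x i) ≤ B := by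
    intro t ht
    refine (bitLen_le_of_natAbs_lt (b := β) ?_).trans hB
    zify
    have h1 := mul_le_mul_of_nonneg_left (hsq t ht) (by omega : (0 : ℤ) ≤ k)
    have h2 := mul_nonneg (by omega : (0 : ℤ) ≤ k) (hsq0 t)
    rw [abs_of_nonneg (by omega)]
    omega
  have hSB : ∀ t ≤ 2 * k, bitLen (∑ i ∈ Finset.range t, x i) ≤ B := by
    intro t ht
    refine le_trans (bitLen_le_of_natAbs_le ?_) (hVB t ht)
    zify
    have h1 : |∑ i ∈ Finset.range t, x i| ≤ ∑ i ∈ Finset.range t, x i * x i :=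
      (Finset.abs_sum_le_sum_abs _ _).trans (Finset.sum_le_sum fun i _ => abs_le_mul_self _)
    have h2 := le_mul_of_one_le_left (hsq0 t) hk0
    have h3 := hsq0 t
    rw [abs_of_nonneg (a := 1 + _) (by omega)]
    omega
  unfold accumulate
  apply Run.le
  · refine Run.assign (k : ℤ) ?_ ((bitLen_natCast_le k).trans (by omega)) (Run.assign 1 rfl
      (le_trans (by decide) hB5) (Run.assign 0 rfl (le_trans (by decide) hB5)
      (Run.cons (n₂ := 1) (Run.loop (N := 2 * k) (T := 5) (fun i s' =>
      s'.reg 0 = (2 * k : ℕ) ∧ s'.reg 1 = k ∧ s'.arr 0 = s.arr 0 ∧ ∃ t : ℕ, t + i = 2 * k ∧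
        s'.reg 23 = t ∧ s'.reg 2 = ∑ i ∈ Finset.range t, x i ∧
        s'.reg 3 = 1 + k * ∑ i ∈ Finset.range t, x i * x i ∧
        ∀ j : ℕ, j < t → s'.arr 1 j = 11) ?_ ?_ ?_))))
    · simp [Exp.eval_div, Exp.eval_reg, Exp.eval_const, h0]
    · exact ⟨by simp [State.setReg_reg, h0], by simp [State.setReg_reg], rfl, 0, by simp,
        by simp [State.setReg_reg], by simp [State.setReg_reg, h2], by simp [State.setReg_reg],
        by simp⟩
    · rintro i s₁ ⟨g0, g1, gA, t, ht, g23, g2, g3, g11⟩ he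
      simp only [Exp.eval_sub, Exp.eval_reg, g0, g23] at he
      obtain ⟨i, rfl⟩ : ∃ i', i = i' + 1 := ⟨i - 1, by omega⟩
      refine ⟨i, rfl, ?_⟩
      apply Run.le
      · refine Run.assign _ ?_ (hSB (t + 1) (by omega)) (Run.assign _ ?_ (hVB (t + 1) (by omega))
          (Run.store t 11 ?_ rfl (le_trans (by decide) hB5) (Run.assign ((t + 1 : ℕ) : ℤ) ?_
          ((bitLen_natCast_le _).trans (by omega)) (Run.nil ⟨?_, ?_, ?_, t + 1, by omega, ?_, ?_,
          ?_, ?_⟩))))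
        · simp [Exp.eval_add, Exp.eval_reg, Exp.eval_read, g23, g2, gA, hx, Finset.sum_range_succ]
        · simp [Exp.eval_add, Exp.eval_mul, Exp.eval_reg, Exp.eval_read, g23, g3, g1, gA, hx,
            Finset.sum_range_succ, State.setReg_reg, State.setReg_arr, mul_add, add_assoc]
        · simp [Exp.eval_reg, State.setReg_reg, g23]
        · simp [Exp.eval_add, Exp.eval_reg, Exp.eval_const, State.setArr_reg, State.setReg_reg, g23]
        · simp [State.setArr_reg, State.setReg_reg, g0]
        · simp [State.setArr_reg, State.setReg_reg, g1]
        · funext j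
          simp [State.setArr_arr, State.setReg_arr, gA]
        · simp [State.setReg_reg]
        · simp [State.setArr_reg, State.setReg_reg]
        · simp [State.setArr_reg, State.setReg_reg]
        · intro j hj
          simp only [State.setArr_arr, State.setReg_arr]
          rcases Nat.lt_succ_iff_lt_or_eq.1 hj with h | rfl
          · rw [if_neg (by omega), g11 j h]
          · simp
      · omega
    · rintro i s₁ ⟨g0, g1, gA, t, ht, g23, g2, g3, g11⟩ he
      simp only [Exp.eval_sub, Exp.eval_reg, g0, g23] at he
      obtain rfl : t = 2 * k := by omega
      exact Run.nil ⟨g0, g1, g2, g3, gA, g11⟩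
  · omega

/-- After t halvings V has become v with V < 2^t(v + 1), so v = 0 gives V < 2^t. Counting from 7
provides the 7 ≤ c that the search for a small prime needs. The initial D = k + 6 forces later
orders above 6, as Bang's theorem requires, and above k. -/
theorem run_measure {k β V : ℕ} (h1 : s.reg 1 = k) (h3 : s.reg 3 = V) (hV : V < 2 ^ β)
    (hB : V < 2 ^ (B - 1))
    (hkB : k * (2 * (7 + β) ^ 2) * (2 * (7 + β) ^ 2) + (2 * (7 + β) ^ 2) + k + 20 ≤ B) :
    Run B measure s (β * 4 + 8) fun s' => ∃ c, 7 ≤ c ∧ c ≤ 7 + β ∧ V < 2 ^ c ∧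
      Frame [3, 4, 5, 6, 7, 24] s s' ∧ s'.reg 4 = (2 * c ^ 2 : ℕ) ∧
      s'.reg 5 = (k * (2 * c ^ 2) * (2 * c ^ 2) : ℕ) ∧ s'.reg 6 = 0 ∧ s'.reg 7 = (k + 6 : ℕ) ∧
      s'.reg 24 = 15 := by
  have small : ∀ v : ℕ, v + 1 ≤ B → bitLen (v : ℤ) ≤ B := fun v hv =>
    (bitLen_natCast_le v).trans (by omega)
  have hβ2 : 7 + β ≤ 2 * (7 + β) ^ 2 := by nlinarith
  unfold measure
  apply Run.le
  · refine Run.assign 7 rfl (le_trans (by decide) (by omega : 5 ≤ B)) (Run.cons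
      (n₂ := 1 + (1 + (1 + (1 + (1 + 1))))) (Run.loop (N := β) (T := 3) (fun i s' =>
      Frame [3, 4, 5, 6, 7, 24] s s' ∧ ∃ t v : ℕ, t + i = β ∧ s'.reg 3 = v ∧
        s'.reg 4 = (7 + t : ℕ) ∧ v < 2 ^ i ∧ v ≤ V ∧ V < 2 ^ t * (v + 1)) ?_ ?_ ?_))
    · exact ⟨(Frame.refl _ s).setReg (by simp) _, 0, V, by simp, by simpa [State.setReg_reg] using h3,
        by simp [State.setReg_reg], hV, le_rfl, by simp⟩
    · rintro i s₁ ⟨hF, t, v, ht, g3, g4, hv, hvV, hVt⟩ he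
      simp only [Exp.eval_reg, g3] at he
      obtain ⟨i, rfl⟩ : ∃ i', i = i' + 1 := by
        rcases i with _ | i
        · rw [pow_zero] at hv; omega
        · exact ⟨i, rfl⟩
      refine ⟨i, rfl, ?_⟩
      apply Run.le
      · refine Run.assign ((v / 2 : ℕ) : ℤ) ?_ ?_ (Run.assign ((7 + (t + 1) : ℕ) : ℤ) ?_
          (small _ (by omega)) (Run.nil ⟨(hF.setReg (by simp) _).setReg (by simp) _, t + 1, v / 2,
          by omega, ?_, ?_, ?_, by omega, ?_⟩))
        · simp [Exp.eval_div, Exp.eval_reg, Exp.eval_const, g3]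
        · have := bitLen_le_of_natAbs_lt (z := ((v / 2 : ℕ) : ℤ)) (b := B - 1)
            (by rw [Int.natAbs_natCast]; omega)
          omega
        · simp [Exp.eval_add, Exp.eval_reg, Exp.eval_const, State.setReg_reg, g4, add_assoc]
        · simp [State.setReg_reg]
        · simp [State.setReg_reg]
        · rw [pow_succ] at hv; omega
        · calc V < 2 ^ t * (v + 1) := hVt
            _ ≤ 2 ^ t * (2 * (v / 2 + 1)) := Nat.mul_le_mul_left _ (by omega)
            _ = _ := by ring
      · omega
    · rintro i s₁ ⟨hF, t, v, ht, g3, g4, hv, hvV, hVt⟩ he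
      simp only [Exp.eval_reg, g3] at he
      obtain rfl : v = 0 := by omega
      have g1 : s₁.reg 1 = k := by rw [hF.2 1 (by simp), h1]
      have hc : 2 * (7 + t) ^ 2 ≤ 2 * (7 + β) ^ 2 := by gcongr; omega
      have hcJ : k * (2 * (7 + t) ^ 2) * (2 * (7 + t) ^ 2) ≤
          k * (2 * (7 + β) ^ 2) * (2 * (7 + β) ^ 2) := by gcongr
      refine Run.assign ((2 * (7 + t) ^ 2 : ℕ) : ℤ) ?_ (small _ (by omega)) (Run.assign
        ((k * (2 * (7 + t) ^ 2) * (2 * (7 + t) ^ 2) : ℕ) : ℤ) ?_ (small _ (by omega))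
        (Run.assign 0 rfl (le_trans (by decide) (by omega : 5 ≤ B))
        (Run.assign ((k + 6 : ℕ) : ℤ) ?_ (small _ (by omega)) (Run.assign 15 rfl
        (le_trans (by decide) (by omega : 5 ≤ B)) (Run.nil ⟨7 + t, by omega, by omega, ?_, ?_, ?_, ?_,
        ?_, ?_, ?_⟩)))))
      · simp [Exp.eval_mul, Exp.eval_reg, Exp.eval_const, g4, pow_two]
      · simp [Exp.eval_mul, Exp.eval_reg, g1, State.setReg_reg]
      · simp [Exp.eval_add, Exp.eval_reg, Exp.eval_const, g1, State.setReg_reg]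
      · calc V < 2 ^ t * (0 + 1) := hVt
          _ ≤ 2 ^ (7 + t) := by
            rw [zero_add, mul_one]; exact Nat.pow_le_pow_right (by norm_num) (by omega)
      · exact ((((hF.setReg (by simp) _).setReg (by simp) _).setReg (by simp) _).setReg
          (by simp) _).setReg (by simp) _
      · simp [State.setReg_reg]
      · simp [State.setReg_reg]
      · simp [State.setReg_reg]
      · simp [State.setReg_reg]
      · simp [State.setReg_reg]
  · omega

theorem run_output {n : ℕ} (hs : s.Bdd B) (h0 : s.reg 0 = n) (hB : n + 2 ≤ B) :
    Run B output s (n * 4 + 5) fun s' => s'.toList =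
      s.reg 24 :: List.ofFn fun i : Fin n => s.arr 1 i := by
  unfold output
  apply Run.le
  · refine Run.assign 0 rfl (le_trans (by decide) (by omega : 2 ≤ B)) (Run.cons
      (n₂ := 1 + (1 + 1)) (Run.loop (N := n) (T := 3) (fun i s' => s'.reg 0 = n ∧
      s'.reg 24 = s.reg 24 ∧ s'.arr 1 = s.arr 1 ∧ ∃ t : ℕ, t + i = n ∧ s'.reg 23 = t ∧
        ∀ j : ℕ, j < t → s'.arr 0 (j + 1 : ℕ) = s.arr 1 j) ?_ ?_ ?_))
    · exact ⟨by simpa [State.setReg_reg] using h0, by simp [State.setReg_reg], rfl, 0, by simp,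
        by simp [State.setReg_reg], by simp⟩
    · rintro i s₁ ⟨g0, g24, gA, t, ht, g23, hj⟩ he
      simp only [Exp.eval_sub, Exp.eval_reg, g0, g23] at he
      obtain ⟨i, rfl⟩ : ∃ i', i = i' + 1 := ⟨i - 1, by omega⟩
      refine ⟨i, rfl, ?_⟩
      apply Run.le
      · refine Run.store ((t + 1 : ℕ) : ℤ) (s.arr 1 t) ?_ ?_ (hs.2 1 t) (Run.assign
          ((t + 1 : ℕ) : ℤ) ?_ ((bitLen_natCast_le _).trans (by omega)) (Run.nil ⟨?_, ?_, ?_, t + 1,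
          by omega, ?_, ?_⟩))
        · simp [Exp.eval_add, Exp.eval_reg, Exp.eval_const, g23]
        · simp [Exp.eval_read, Exp.eval_reg, g23, gA]
        · simp [Exp.eval_add, Exp.eval_reg, Exp.eval_const, State.setArr_reg, g23]
        · simp [State.setArr_reg, State.setReg_reg, g0]
        · simp [State.setArr_reg, State.setReg_reg, g24]
        · funext j
          simp [State.setReg_arr, State.setArr_arr, gA]
        · simp [State.setReg_reg]
        · intro j hjt
          simp only [State.setReg_arr, State.setArr_arr]
          rcases Nat.lt_succ_iff_lt_or_eq.1 hjt with h | rfl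
          · rw [if_neg (by omega), hj j h]
          · simp
      · omega
    · rintro i s₁ ⟨g0, g24, gA, t, ht, g23, hj⟩ he
      simp only [Exp.eval_sub, Exp.eval_reg, g0, g23] at he
      obtain rfl : t = n := by omega
      refine Run.store 0 (s.reg 24) rfl ?_ (hs.1 24) (Run.assign ((t + 1 : ℕ) : ℤ) ?_
        ((bitLen_natCast_le _).trans (by omega)) (Run.nil ?_))
      · rw [Exp.eval_reg, g24]
      · simp [Exp.eval_add, Exp.eval_reg, Exp.eval_const, State.setArr_reg, g0]
      · have hlen : (((s₁.setArr 0 0 (s.reg 24)).setReg 0 ((t + 1 : ℕ) : ℤ)).reg 0).toNat = t + 1 := by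
          rw [State.setReg_reg, if_pos rfl, Int.toNat_natCast]
        refine List.ext_getElem (by
          simp only [State.toList, List.length_map, List.length_range, hlen, List.length_cons,
            List.length_ofFn]) fun i h₁ h₂ => ?_
        simp only [State.toList, List.getElem_map, List.getElem_range, State.setReg_arr,
          State.setArr_arr]
        rcases i with _ | i
        · simp
        · rw [if_neg (by omega)]
          simp only [List.getElem_cons_succ, List.getElem_ofFn]
          exact hj i (by simpa using h₂)
  · omega

end RAM

/-! ### The main loop and its resource bounds. -/

namespace RAM
variable {B : ℕ} {s : State}

theorem Run.and_bdd {n : ℕ} {p : Prog} {Q : State → Prop} (h : Run B p s n Q) (hB : 1 ≤ B)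
    (hs : s.Bdd B) : Run B p s n fun s' => s'.Bdd B ∧ Q s' := by
  obtain ⟨m, hm, s', hst, hQ⟩ := h
  exact ⟨m, hm, s', hst, (hst.exec hB hs).1, hQ⟩

/-- The number of rounds. -/
def rounds (k c : ℕ) : ℕ := k * (2 * c ^ 2) * (2 * c ^ 2)

/-- An upper bound for the multiplicative orders in use. -/
def orderBound (k c : ℕ) : ℕ := k + 6 + rounds k c * (2 * c ^ 2 * (k + 1))

/-- An upper bound for the bit length of the moduli and for all counters. -/
def sizeBound (k c : ℕ) : ℕ :=
  (4 + rounds k c * orderBound k c) + (1 + k * (orderBound k c + 1)) + (2 * k + 1) +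
    (2 * c ^ 2 + 1) + (rounds k c + 1)

/-- Killed sets stay killed, because M only gains factors and the residues modulo the old M persist;
rounds that kill nothing useful still preserve admissibility. Each round adds at most `orderBound k
c` bits to M, starting from 15 < 2^4. -/
theorem run_rounds {k c b : ℕ} {S : ℤ} (hk : Odd k) (h0 : s.reg 0 = (2 * k : ℕ))
    (h1 : s.reg 1 = k) (h2 : s.reg 2 = S) (h4 : s.reg 4 = (2 * c ^ 2 : ℕ))
    (h5 : s.reg 5 = (rounds k c : ℕ)) (h6 : s.reg 6 = 0) (h7 : s.reg 7 = (k + 6 : ℕ))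
    (h24 : s.reg 24 = 15) (h11 : ∀ i : ℕ, i < 2 * k → s.arr 1 i = 11)
    (hb : sizeBound k c ≤ b) (hB : 2 * b + 3 ≤ B) :
    Run B (.loop (.reg 5 - .reg 6) round) s (rounds k c * (b * (32 * b + 35) + 41) + 1) fun s' =>
      s'.reg 0 = (2 * k : ℕ) ∧ ∃ (M : ℕ) (D : ℕ), s'.reg 24 = M ∧
        Admissible k (fun i : Fin (2 * k) => (2 * k : ℕ) * s.arr 0 i - S) D M
          (fun i : Fin (2 * k) => s'.arr 1 i) ∧
        ∀ j < rounds k c, ∀ I, Scheduled k (2 * c ^ 2)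
          (fun i : Fin (2 * k) => (2 * k : ℕ) * s.arr 0 i - S) j I →
          Kills M (fun i : Fin (2 * k) => s'.arr 1 i) I := by
  set z := fun i : Fin (2 * k) => (2 * k : ℕ) * s.arr 0 i - S with hz
  refine Run.loop (T := b * (32 * b + 35) + 40) (fun i s' => s'.arr 0 = s.arr 0 ∧
    (∀ x, x ∈ [0, 1, 2, 4, 5] → s'.reg x = s.reg x) ∧ ∃ (j : ℕ) (D : ℕ) (M : ℤ),
      j + i = rounds k c ∧ s'.reg 6 = j ∧ s'.reg 7 = D ∧ k + 6 ≤ D ∧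
      D ≤ k + 6 + j * (2 * c ^ 2 * (k + 1)) ∧ s'.reg 24 = M ∧
      M < 2 ^ (4 + j * orderBound k c) ∧ Admissible k z D M (fun i : Fin (2 * k) => s'.arr 1 i) ∧
      ∀ j' < j, ∀ I, Scheduled k (2 * c ^ 2) z j' I → Kills M (fun i : Fin (2 * k) => s'.arr 1 i) I) ?_ ?_ ?_
  · have e11 : (fun i : Fin (2 * k) => s.arr 1 i) = fun _ => 11 := funext fun i => h11 i i.2
    refine ⟨rfl, fun _ _ => rfl, 0, k + 6, 15, by simp, by simpa using h6, h7, le_rfl, by simp, h24,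
      by simp, ?_, by simp⟩
    rw [e11]
    exact Admissible.base hk z (by omega)
  · rintro i s₁ ⟨hA, hR, j, D, M, hji, g6, g7, hDl, hDu, g24, hM, hAd, hK⟩ he
    simp only [Exp.eval_sub, Exp.eval_reg, hR 5 (by simp), h5, g6] at he
    obtain ⟨i, rfl⟩ : ∃ i', i = i' + 1 := ⟨i - 1, by omega⟩
    refine ⟨i, rfl, ?_⟩
    have hjJ : j + 1 ≤ rounds k c := by omega
    have hk0 := hk.pos
    have hX0 : 0 < 2 * c ^ 2 := by
      rcases Nat.eq_zero_or_pos (2 * c ^ 2) with h | h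
      · simp [rounds, h] at hjJ
      · exact h
    have hlk : j % k + 1 ≤ k := Nat.mod_lt _ hk0
    have hqX : j / k % (2 * c ^ 2) + 1 ≤ 2 * c ^ 2 := Nat.mod_lt _ hX0
    obtain ⟨l, hl⟩ : ∃ l, l = j % k + 1 := ⟨_, rfl⟩
    obtain ⟨q, hq⟩ : ∃ q, q = j / k % (2 * c ^ 2) + 1 := ⟨_, rfl⟩
    obtain ⟨σ, hσ⟩ : ∃ σ, σ = D / (q * l) + 1 := ⟨_, rfl⟩
    obtain ⟨d, hd⟩ : ∃ d, d = q * (1 + l * σ) := ⟨_, rfl⟩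
    have hDd : D < d := by
      rw [hd, hσ]; exact lt_next_order D l q (by omega) (by omega)
    have hdD : d ≤ D + 2 * c ^ 2 * (k + 1) := by
      rw [hd, hσ]
      refine (next_order_le D l q).trans ?_
      gcongr <;> omega
    have hdj : d ≤ k + 6 + (j + 1) * (2 * c ^ 2 * (k + 1)) := by
      rw [add_mul, one_mul]; omega
    have hdB : d ≤ orderBound k c := by
      refine hdj.trans ?_
      unfold orderBound
      gcongr
    have hμ : 4 + j * orderBound k c + d ≤ 4 + (j + 1) * orderBound k c := by
      rw [add_mul, one_mul]; omega
    have hμ' : 4 + (j + 1) * orderBound k c ≤ 4 + rounds k c * orderBound k c := by gcongr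
    have hσD : σ ≤ orderBound k c + 1 := by
      have := Nat.div_le_self D (q * l); omega
    have hf : 1 + k * σ ≤ 1 + k * (orderBound k c + 1) := by gcongr
    unfold sizeBound at hb
    refine (run_round (k := k) (X := 2 * c ^ 2) (j := j) (D := D) (l := l) (q := q) (σ := σ) (d := d)
      (b := b) (μ := 4 + j * orderBound k c) (S := S) (M := M) (by rw [hR 0 (by simp), h0])
      (by rw [hR 1 (by simp), h1]) (by rw [hR 2 (by simp), h2]) (by rw [hR 4 (by simp), h4]) g6 g7
      g24 hAd.pos hM hl hq rfl hσ hd (by omega) (by omega) (by omega) (by omega) (by omega) hB).mono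
      le_rfl ?_
    rintro s₂ ⟨hR₂, hA₂, k6, k7, m, k24, hm, hround⟩
    rw [hA] at hround
    refine ⟨hA₂.trans hA, fun x hx => (hR₂ x hx).trans (hR x hx), j + 1, d, M * m, by omega, k6, k7,
      by omega, hdj, k24, ?_, ?_, ?_⟩
    · calc M * m < 2 ^ (4 + j * orderBound k c) * 2 ^ d :=
          mul_lt_mul'' hM hm hAd.pos.le hround.pos.le
        _ = 2 ^ (4 + j * orderBound k c + d) := (pow_add _ _ _).symm
        _ ≤ _ := pow_le_pow_right₀ (by norm_num) hμ
    · have := hround.admissible hAd hk (by omega) (hd ▸ hDd.le)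
      rwa [← hd] at this
    · intro j' hj' I hI
      rcases Nat.lt_succ_iff_lt_or_eq.1 hj' with h | rfl
      · exact hround.kills_of_kills (hK j' h I hI)
      · subst hl hq hσ
        exact hround.kills_of_scheduled hAd (hd ▸ hDd) hDl hI
  · rintro i s₁ ⟨hA, hR, j, D, M, hji, g6, g7, hDl, hDu, g24, hM, hAd, hK⟩ he
    simp only [Exp.eval_sub, Exp.eval_reg, hR 5 (by simp), h5, g6] at he
    obtain rfl : j = rounds k c := by omega
    have hM' : ((M.toNat : ℕ) : ℤ) = M := Int.toNat_of_nonneg hAd.pos.le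
    exact ⟨by rw [hR 0 (by simp), h0], M.toNat, D, by rw [g24, hM'], by rwa [hM'], by rwa [hM']⟩

theorem rounds_mono {k k' c c' : ℕ} (hk : k ≤ k') (hc : c ≤ c') : rounds k c ≤ rounds k' c' := by
  unfold rounds; gcongr

theorem orderBound_mono {k k' c c' : ℕ} (hk : k ≤ k') (hc : c ≤ c') :
    orderBound k c ≤ orderBound k' c' := by
  have := rounds_mono hk hc
  unfold orderBound; gcongr

theorem sizeBound_mono {k k' c c' : ℕ} (hk : k ≤ k') (hc : c ≤ c') :
    sizeBound k c ≤ sizeBound k' c' := by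
  have := rounds_mono hk hc
  have := orderBound_mono hk hc
  unfold sizeBound; gcongr

/-- For an input of size `n`, an upper bound for all numbers in `sizeBound`. -/
def memSize (n : ℕ) : ℕ := sizeBound n (4 * n + 8)

/-- For an input of size `n`, an upper bound for the bit length of all numbers in memory. -/
def memBound (n : ℕ) : ℕ := 2 * memSize n + 4 * n + 28

/-- For an input of size `n`, an upper bound for the number of instructions. -/
def stepBound (n : ℕ) : ℕ :=
  rounds n (4 * n + 8) * (memSize n * (32 * memSize n + 35) + 41) + 30 * n + 30

/-- With V = 1 + kΣx_i² < 2^(4n+1), the measured c is at most 7 + (4n + 1), whence the argument 4n +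
8 in the bounds. -/
theorem run_mainProg {k n : ℕ} {x : ℕ → ℤ} (hk : Odd k) (hkn : 2 * k ≤ n)
    (h0 : s.reg 0 = (2 * k : ℕ)) (h2 : s.reg 2 = 0) (hx : ∀ i : ℕ, s.arr 0 i = x i)
    (hV : 1 + k * ∑ i ∈ Finset.range (2 * k), x i * x i < 2 ^ (4 * n + 1))
    (hs : s.Bdd (memBound n)) :
    Run (memBound n) mainProg s (stepBound n) fun s' => ∃ (M : ℕ) (a : Fin (2 * k) → ℤ) (c D : ℕ),
      s'.toList = (M : ℤ) :: List.ofFn a ∧ 7 ≤ c ∧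
      1 + k * ∑ i ∈ Finset.range (2 * k), x i * x i < 2 ^ c ∧
      Admissible k (fun i : Fin (2 * k) => (2 * k : ℕ) * x i - ∑ i ∈ Finset.range (2 * k), x i) D M
        a ∧
      ∀ j < rounds k c, ∀ I, Scheduled k (2 * c ^ 2)
        (fun i : Fin (2 * k) => (2 * k : ℕ) * x i - ∑ i ∈ Finset.range (2 * k), x i) j I →
        Kills M a I := by
  obtain ⟨V, hVV⟩ : ∃ V : ℕ, (V : ℤ) = 1 + k * ∑ i ∈ Finset.range (2 * k), x i * x i :=
    ⟨_, Int.toNat_of_nonneg (add_nonneg zero_le_one (mul_nonneg (by positivity)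
      (Finset.sum_nonneg fun i _ => mul_self_nonneg (x i))))⟩
  have hV' : V < 2 ^ (4 * n + 1) := by
    rw [← hVV] at hV; exact_mod_cast hV
  have hmem : sizeBound n (4 * n + 8) = memSize n := rfl
  have hB : memBound n = 2 * memSize n + 4 * n + 28 := rfl
  have hsize : k * (2 * (7 + (4 * n + 1)) ^ 2) * (2 * (7 + (4 * n + 1)) ^ 2) +
      2 * (7 + (4 * n + 1)) ^ 2 + k ≤ memSize n := by
    rw [← hmem, show 7 + (4 * n + 1) = 4 * n + 8 by ring]
    have e1 : rounds k (4 * n + 8) ≤ rounds n (4 * n + 8) := rounds_mono (by omega) le_rfl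
    have e2 : k * (2 * (4 * n + 8) ^ 2) * (2 * (4 * n + 8) ^ 2) = rounds k (4 * n + 8) := rfl
    unfold sizeBound
    omega
  unfold mainProg
  obtain ⟨N₃, hN₃⟩ : ∃ N, N = 2 * k * 4 + 5 + 1 := ⟨_, rfl⟩
  obtain ⟨N₂, hN₂⟩ : ∃ N, N =
    (rounds n (4 * n + 8) * (memSize n * (32 * memSize n + 35) + 41) + 1) + N₃ := ⟨_, rfl⟩
  obtain ⟨N₁, hN₁⟩ : ∃ N, N = ((4 * n + 1) * 4 + 8) + N₂ := ⟨_, rfl⟩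
  apply Run.le
  · refine Run.cons (n₂ := N₁) (((run_accumulate (β := 4 * n + 1) hk.pos h0 h2 hx hV (by omega)
      (by omega) (by omega)).and_bdd (by omega) hs).mono le_rfl ?_)
    rintro s₁ ⟨hs₁, a0, a1, a2, a3, aA, a11⟩
    rw [hN₁]
    refine Run.cons (n₂ := N₂) (((run_measure (β := 4 * n + 1) a1 (a3.trans hVV.symm) hV'
      (hV'.trans_le (Nat.pow_le_pow_right (by norm_num) (by omega))) (by omega)).and_bdd (by omega)
      hs₁).mono le_rfl ?_)
    rintro s₂ ⟨hs₂, c, hc7, hcn, hVc, hF, b4, b5, b6, b7, b24⟩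
    have hc : c ≤ 4 * n + 8 := by omega
    rw [hN₂]
    refine Run.cons (n₂ := N₃) (((run_rounds (c := c) (b := memSize n) (S := s₂.reg 2) hk
      (by rw [hF.2 0 (by simp), a0]) (by rw [hF.2 1 (by simp), a1]) rfl b4 b5 b6 b7 b24
      (by rw [hF.1]; exact a11) (sizeBound_mono (by omega) hc) (by omega)).and_bdd (by omega)
      hs₂).mono ?_ ?_)
    · have := rounds_mono (k := k) (k' := n) (by omega) hc
      gcongr
    rintro s₃ ⟨hs₃, d0, M, D, d24, hAd, hK⟩
    rw [hN₃]
    refine Run.cons (n₂ := 1) ((run_output (n := 2 * k) hs₃ d0 (by omega)).mono le_rfl ?_)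
    intro s₄ hlist
    have hzz : (fun i : Fin (2 * k) => ((2 * k : ℕ) : ℤ) * s₂.arr 0 i - s₂.reg 2) =
        fun i : Fin (2 * k) => ((2 * k : ℕ) : ℤ) * x i - ∑ i ∈ Finset.range (2 * k), x i := by
      funext i
      rw [hF.1, aA, hx, hF.2 2 (by simp), a2]
    rw [hzz] at hAd hK
    exact Run.nil ⟨M, _, c, D, by rw [hlist, d24], hc7, by rw [← hVV]; exact_mod_cast hVc, hAd, hK⟩
  · unfold stepBound
    omega

/-! ### Polynomial bounds in the input size. -/

/-- Functions given by a polynomial. -/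
def IsPolynomial (f : ℕ → ℕ) : Prop := ∃ P : Polynomial ℕ, ∀ n, P.eval n = f n

theorem IsPolynomial.const (c : ℕ) : IsPolynomial fun _ => c := ⟨.C c, fun _ => by simp⟩

theorem IsPolynomial.id : IsPolynomial fun n => n := ⟨.X, fun _ => by simp⟩

theorem IsPolynomial.add {f g : ℕ → ℕ} (hf : IsPolynomial f) (hg : IsPolynomial g) :
    IsPolynomial fun n => f n + g n := by
  obtain ⟨P, hP⟩ := hf
  obtain ⟨Q, hQ⟩ := hg
  exact ⟨P + Q, fun n => by simp [hP, hQ]⟩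

theorem IsPolynomial.mul {f g : ℕ → ℕ} (hf : IsPolynomial f) (hg : IsPolynomial g) :
    IsPolynomial fun n => f n * g n := by
  obtain ⟨P, hP⟩ := hf
  obtain ⟨Q, hQ⟩ := hg
  exact ⟨P * Q, fun n => by simp [hP, hQ]⟩

theorem IsPolynomial.pow {f : ℕ → ℕ} (hf : IsPolynomial f) (c : ℕ) :
    IsPolynomial fun n => f n ^ c := by
  obtain ⟨P, hP⟩ := hf
  exact ⟨P ^ c, fun n => by simp [hP]⟩

theorem IsPolynomial.rounds {f g : ℕ → ℕ} (hf : IsPolynomial f) (hg : IsPolynomial g) :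
    IsPolynomial fun n => rounds (f n) (g n) :=
  have h := (const 2).mul (hg.pow 2)
  (hf.mul h).mul h

theorem IsPolynomial.orderBound {f g : ℕ → ℕ} (hf : IsPolynomial f) (hg : IsPolynomial g) :
    IsPolynomial fun n => orderBound (f n) (g n) :=
  (hf.add (const 6)).add ((hf.rounds hg).mul (((const 2).mul (hg.pow 2)).mul (hf.add (const 1))))

theorem IsPolynomial.memSize : IsPolynomial memSize :=
  have hf := IsPolynomial.id
  have hg := ((const 4).mul hf).add (const 8)
  have hJ := hf.rounds hg
  have hD := hf.orderBound hg
  ((((const 4).add (hJ.mul hD)).add ((const 1).add (hf.mul (hD.add (const 1))))).add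
    (((const 2).mul hf).add (const 1))).add (((const 2).mul (hg.pow 2)).add (const 1)) |>.add
    (hJ.add (const 1))

theorem IsPolynomial.memBound : IsPolynomial memBound :=
  (((const 2).mul memSize).add ((const 4).mul id)).add (const 28)

theorem IsPolynomial.stepBound : IsPolynomial stepBound :=
  (((id.rounds (((const 4).mul id).add (const 8))).mul
    ((memSize.mul (((const 32).mul memSize).add (const 35))).add (const 41))).add
    ((const 30).mul id)).add (const 30)

theorem length_le_inputSize (l : List ℤ) : l.length ≤ inputSize l := by
  induction l with
  | nil => simp
  | cons a l ih =>
    have := bitLen_pos a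
    simp only [inputSize, List.map_cons, List.sum_cons, List.length_cons] at ih ⊢
    omega

theorem bitLen_le_inputSize {l : List ℤ} {v : ℤ} (hv : v ∈ l) : bitLen v ≤ inputSize l :=
  List.single_le_sum (by simp) _ (List.mem_map_of_mem hv)

theorem State.ofList_bdd (l : List ℤ) : (State.ofList l).Bdd (inputSize l + 1) := by
  have h0 : bitLen 0 ≤ inputSize l + 1 := le_trans (by decide) (Nat.le_add_left 1 _)
  refine ⟨fun x => ?_, fun a i => ?_⟩
  · simp only [State.ofList]
    split_ifs
    · exact (bitLen_natCast_le _).trans (Nat.succ_le_succ (length_le_inputSize l))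
    · exact h0
  · simp only [State.ofList]
    split_ifs
    · rw [List.getD_eq_getElem?_getD]
      rcases h : l[i.toNat]? with _ | v
      · simpa using h0
      · exact (bitLen_le_inputSize (List.mem_of_getElem? h)).trans (Nat.le_succ _)
    · exact h0

/-- There are 2k squares, each at most 2^(2n), and k and 2k are each at most 2^n. -/
theorem one_add_mul_sum_sq_lt {k n : ℕ} {x : ℕ → ℤ} (hn : 0 < n) (hkn : 2 * k ≤ n)
    (hx : ∀ i < 2 * k, bitLen (x i) ≤ n) :
    1 + k * ∑ i ∈ Finset.range (2 * k), x i * x i < 2 ^ (4 * n + 1) := by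
  have h1 : ∀ i ∈ Finset.range (2 * k), x i * x i ≤ (2 : ℤ) ^ (2 * n) := by
    intro i hi
    have h2 := natAbs_lt_two_pow_bitLen (x i)
    have h3 : 2 ^ (bitLen (x i) - 1) ≤ 2 ^ n :=
      Nat.pow_le_pow_right (by norm_num) (by have := hx i (Finset.mem_range.1 hi); omega)
    have h4 : (x i).natAbs * (x i).natAbs ≤ 2 ^ n * 2 ^ n := Nat.mul_le_mul (by omega) (by omega)
    rw [← Int.natAbs_mul_self, two_mul, pow_add]
    exact_mod_cast h4
  have h5 := Finset.sum_le_card_nsmul _ _ _ h1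
  rw [Finset.card_range, nsmul_eq_mul] at h5
  have hn : (n : ℤ) < 2 ^ n := by exact_mod_cast Nat.lt_two_pow_self
  have hkn' : 2 * (k : ℤ) ≤ n := by exact_mod_cast hkn
  push_cast at h5
  have hp : (1 : ℤ) ≤ 2 ^ n := one_le_pow₀ (by norm_num)
  calc 1 + (k : ℤ) * ∑ i ∈ Finset.range (2 * k), x i * x i
      ≤ 1 + k * (2 * k * 2 ^ (2 * n)) := by gcongr
    _ ≤ 1 + 2 ^ n * (2 ^ n * 2 ^ (2 * n)) := by gcongr <;> omega
    _ = 1 + 2 ^ (4 * n) := by rw [← pow_add, ← pow_add]; congr 2; ring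
    _ < 2 ^ (4 * n + 1) := by
      have h6 : (2 : ℤ) ^ 1 ≤ 2 ^ (4 * n) := pow_le_pow_right₀ (by norm_num) (by omega)
      rw [pow_succ]
      omega

end RAM

/-! ### The algorithm meets the specification. -/

theorem mainTheorem6 :
    ∃ (alg : RAM.Prog) (P : Polynomial ℕ),
      ∀ (k : ℕ), Odd k → ∀ (x : Fin (2 * k) → ℤ),
        ∃ (M : ℕ) (a : Fin (2 * k) → ℤ),
          alg.OutputsWithin (List.ofFn x) ((M : ℤ) :: List.ofFn a)
            (P.eval (RAM.inputSize (List.ofFn x))) ∧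
          0 < M ∧
          (∀ i, Int.gcd (a i) M = 1) ∧
          ∀ (N : Fin (2 * k) → ℤ), (∀ i, N i ≡ a i [ZMOD M]) →
            (∀ I : Finset (Fin (2 * k)), I.card ≤ k →
              (Int.gcd (2 * ∏ i ∈ I, N i + 1) M = 1 ↔
                I.card = k ∧ ∑ i ∈ I, (x i : ℚ) = (∑ i, (x i : ℚ)) / 2)) ∧
            (∀ i, ¬ (N i - 1 ∣ 4 * ∏ j, N j)) ∧
            1 < Int.gcd (2 * ∏ j, N j + 1) M ∧
            1 < Int.gcd (4 * ∏ j, N j + 1) M := by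
  -- The time bound is the number of instructions times the weight of the program times the square
  -- of the memory bound.
  obtain ⟨P, hP⟩ := RAM.IsPolynomial.stepBound.mul
    ((RAM.IsPolynomial.const RAM.mainProg.weight).mul (RAM.IsPolynomial.memBound.pow 2))
  refine ⟨RAM.mainProg, P, fun k hk x => ?_⟩
  set n := RAM.inputSize (List.ofFn x) with hn
  have hkn : 2 * k ≤ n := by simpa using RAM.length_le_inputSize (List.ofFn x)
  -- Extension of x by 0, matching the way the input is laid out in memory.
  set y : ℕ → ℤ := fun i => (List.ofFn x).getD i 0 with hy
  have hyx : ∀ i : Fin (2 * k), y i = x i := fun i => by simp [hy]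
  have hyB : ∀ i < 2 * k, RAM.bitLen (y i) ≤ n := fun i hi => by
    rw [hyx ⟨i, hi⟩]
    exact RAM.bitLen_le_inputSize (List.mem_ofFn.2 ⟨_, rfl⟩)
  have hbdd : (RAM.State.ofList (List.ofFn x)).Bdd (RAM.memBound n) := by
    have h := RAM.State.ofList_bdd (List.ofFn x)
    have hle : n + 1 ≤ RAM.memBound n := by unfold RAM.memBound; omega
    exact ⟨fun r => (h.1 r).trans hle, fun r i => (h.2 r i).trans hle⟩
  obtain ⟨t, ht, s, hsteps, M, a, c, D, hlist, hc7, hVc, hAd, hK⟩ :=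
    RAM.run_mainProg (s := RAM.State.ofList (List.ofFn x)) (x := y) hk hkn (by simp [RAM.State.ofList])
      rfl (fun i => by simp [RAM.State.ofList, hy]) (RAM.one_add_mul_sum_sq_lt (by have := hk.pos; omega) hkn hyB) hbdd
  obtain ⟨-, T, hT, hexec⟩ := hsteps.exec (by unfold RAM.memBound; omega) hbdd
  have hsum : ∑ i ∈ Finset.range (2 * k), y i = ∑ i, x i := by
    rw [← Fin.sum_univ_eq_sum_range y]; simp only [hyx]
  have hsq : ∑ i ∈ Finset.range (2 * k), y i * y i = ∑ i, x i * x i := by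
    rw [← Fin.sum_univ_eq_sum_range fun i => y i * y i]; simp only [hyx]
  rw [hsq] at hVc
  simp only [hsum, hyx] at hAd hK
  refine ⟨M, a, ⟨T, s, ?_, hexec, hlist⟩, conclusion hk hc7 (by omega) hAd hK⟩
  rw [hP]
  exact hT.trans (Nat.mul_le_mul_right _ ht)
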